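/- Let $k\ge 1$ be an integer and let $(\lambda_k,\eta_k)$ be a universal pair of order $k$ for critical circle maps with golden mean rotation number, that is: $-1<\lambda_k<0$; $\eta_k$ is holomorphic on an open set $D_k\subset\mathbb C$ containing $\mathbb R$; on $\mathbb R$ it is real, strictly increasing, satisfies $\eta_k(x)\le x$ and $\eta_k(x)=H_k(x^{2k+1})$ with $H_k$ real analytic on $\mathbb R$; $\eta_k(0)=\lambda_k$; and for all $x\in\mathbb R$ $$\eta_k(x)=\frac1{\lambda_k}\,\eta_k\Big(\frac1{\lambda_k}\eta_k(\lambda_k^2x)\Big),\qquad \eta_k(x)=\frac1{\lambda_k^2}\,\eta_k\big(\lambda_k\,\eta_k(\lambda_kx)\big).$$ For a compact set $B\subset D_k$ with connected non-empty interior, let $H(B)$ be the Banach space of continuous functions $B\to\mathbb C$ that are holomorphic in the interior of $B$, with the supremum norm. (If $B$ is symmetric under complex conjugation, $H(B)$ is the complexification of the space of those functions that are real on $B\cap\mathbb R$.) Consider, for $p\ge0$, the operators $$Rh(z)=h\big(\lambda_k^{-1}\eta_k(\lambda_k^2z)\big),\qquad T_pq(z)=\big[\eta_k'\big(\lambda_k^{-1}\eta_k(\lambda_k^2z)\big)\big]^p\,q(\lambda_k^2z),$$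 $$U_ph(z)=\big[\eta_k'\big(\lambda_k\eta_k(\lambda_kz)\big)\big]^p\,h(\lambda_kz),\qquad Pq(z)=q\big(\lambda_k\eta_k(\lambda_kz)\big),$$ where the powers are taken with the principal branch, and the Lindeberg--Lyapunov operators on $H(B)\times H(B)$ $$\mathcal K_p=\begin{pmatrix}R&T_p\\ I&0\end{pmatrix},\qquad \widehat{\mathcal K}_p=\begin{pmatrix}U_p&P\\ I&0\end{pmatrix}.$$ For $\mathcal K_p$, assume that the maps $z\mapsto\lambda_k^2z$ and $z\mapsto\lambda_k^{-1}\eta_k(\lambda_k^2z)$ send $B$ into its interior and that $\eta_k'(\lambda_k^{-1}\eta_k(\lambda_k^2z))\notin(-\infty,0]$ for $z\in B$. For $\widehat{\mathcal K}_p$, assume that $z\mapsto\lambda_kz$ and $z\mapsto\lambda_k\eta_k(\lambda_kz)$ send $B$ into its interior and that $\eta_k'(\lambda_k\eta_k(\lambda_kz))\notin(-\infty,0]$ for $z\in B$. Let $\rho_p$ be the spectral radius of $\mathcal K_p$. Then: * [K1] $\lambda_k^{2kp}\rho_p>1$ for all $p>0$, where $\lambda_k^{2kp}=(\lambda_k^{2k})^p$;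 * [K2] the map $p\mapsto\rho_p$ is positive and strictly log-convex on $[0,\infty)$; * [K3] the map $p\mapsto\log(\rho_p)/p$ is strictly decreasing on $(0,\infty)$. The same three statements hold for the spectral radius $\widehat\rho_p$ of $\widehat{\mathcal K}_p$. -/

import Mathlib

open Set Topology TopologicalSpace

noncomputable section

/-- The data of a universal pair `(lam, η)` of order `k` of golden mean critical circle maps:
`η` is holomorphic on an open set `D` containing the real line, real and strictly increasing on
the real line with `η x ≤ x`, of the form `η x = H (x ^ (2k+1))` with `H` analytic, and it solves
the two fixed point equations of the renormalization of critical circle maps with the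
normalization `η 0 = lam`, where `-1 < lam < 0`. -/
structure IsUniversalPair (k : ℕ) (lam : ℝ) (D : Set ℂ) (η : ℂ → ℂ) : Prop where
  isOpen : IsOpen D
  real_subset : ∀ x : ℝ, (x : ℂ) ∈ D
  holomorphic : DifferentiableOn ℂ η D
  real : ∀ x : ℝ, (η x).im = 0
  strictMono : StrictMono fun x : ℝ => (η x).re
  le_self : ∀ x : ℝ, (η x).re ≤ x
  critical : ∃ H : ℝ → ℝ, AnalyticOnNhd ℝ H univ ∧ ∀ x : ℝ, (η x).re = H (x ^ (2 * k + 1))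
  lam_gt : -1 < lam
  lam_lt : lam < 0
  normalized : η 0 = lam
  fixed_one : ∀ x : ℝ, η x = (lam : ℂ)⁻¹ * η ((lam : ℂ)⁻¹ * η ((lam : ℂ) ^ 2 * x))
  fixed_two : ∀ x : ℝ, η x = ((lam : ℂ) ^ 2)⁻¹ * η ((lam : ℂ) * η ((lam : ℂ) * x))

/-- The map `z ↦ lam⁻¹ η (lam² z)`. -/
def phiMap (lam : ℝ) (η : ℂ → ℂ) (z : ℂ) : ℂ := (lam : ℂ)⁻¹ * η ((lam : ℂ) ^ 2 * z)

/-- The map `z ↦ lam η (lam z)`. -/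
def psiMap (lam : ℝ) (η : ℂ → ℂ) (z : ℂ) : ℂ := (lam : ℂ) * η ((lam : ℂ) * z)

/-- Domains on which the operator `K_p` acts: `B` is a compact subset of `D` with connected
interior that is mapped into its interior by `z ↦ lam² z` and by `z ↦ lam⁻¹ η (lam² z)`, and on
which `η' (lam⁻¹ η (lam² z))` avoids the half-line `(-∞, 0]`, so that its powers are defined by
the principal branch. -/
structure IsDomainK (lam : ℝ) (D : Set ℂ) (η : ℂ → ℂ) (B : Compacts ℂ) : Prop where
  subset : (B : Set ℂ) ⊆ D
  connected : IsConnected (interior (B : Set ℂ))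
  mapsTo_mul : MapsTo (fun z : ℂ => (lam : ℂ) ^ 2 * z) B (interior (B : Set ℂ))
  mapsTo_phi : MapsTo (phiMap lam η) B (interior (B : Set ℂ))
  slit : ∀ z ∈ B, deriv η (phiMap lam η z) ∈ Complex.slitPlane

/-- Domains on which the operator `hat K_p` acts: as for `K_p`, with the maps `z ↦ lam z` and
`z ↦ lam η (lam z)`. -/
structure IsDomainKHat (lam : ℝ) (D : Set ℂ) (η : ℂ → ℂ) (B : Compacts ℂ) : Prop where
  subset : (B : Set ℂ) ⊆ D
  connected : IsConnected (interior (B : Set ℂ))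
  mapsTo_mul : MapsTo (fun z : ℂ => (lam : ℂ) * z) B (interior (B : Set ℂ))
  mapsTo_psi : MapsTo (psiMap lam η) B (interior (B : Set ℂ))
  slit : ∀ z ∈ B, deriv η (psiMap lam η z) ∈ Complex.slitPlane

/-- Extension by zero of a function on the compact set `B`. -/
def extZero {B : Compacts ℂ} (h : C(B, ℂ)) : ℂ → ℂ := Function.extend Subtype.val h 0

theorem extZero_apply {B : Compacts ℂ} (h : C(B, ℂ)) (z : B) : extZero h z = h z :=
  Subtype.val_injective.extend_apply _ _ z

theorem extZero_eq {B : Compacts ℂ} (h : C(B, ℂ)) {z : ℂ} (hz : z ∈ B) :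
    extZero h z = h ⟨z, hz⟩ :=
  extZero_apply h ⟨z, hz⟩

/-- The space `H(B)` of continuous functions on the compact set `B` that are holomorphic in the
interior of `B`, with the supremum norm. If `B` is symmetric under complex conjugation, it is the
complexification of its real subspace of functions that are real on `B ∩ ℝ`. -/
def HolC (B : Compacts ℂ) : Submodule ℂ C(B, ℂ) where
  carrier := {h | DifferentiableOn ℂ (extZero h) (interior (B : Set ℂ))}
  zero_mem' := by
    refine (differentiableOn_const (0 : ℂ)).congr fun z hz => ?_
    simp [extZero_eq _ (interior_subset hz)]
  add_mem' := by
    intro f g hf hg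
    refine (DifferentiableOn.add hf hg).congr fun z hz => ?_
    simp [extZero_eq _ (interior_subset hz)]
  smul_mem' := by
    intro c f hf
    refine (DifferentiableOn.const_smul hf c).congr fun z hz => ?_
    simp [extZero_eq _ (interior_subset hz)]

/-- The element of `H(B)` given by a function on the plane. -/
def HolC.mk {B : Compacts ℂ} (w : ℂ → ℂ) (hc : ContinuousOn w B)
    (hd : DifferentiableOn ℂ w (interior (B : Set ℂ))) : HolC B :=
  ⟨⟨fun z => w z, hc.comp_continuous continuous_subtype_val fun z => z.2⟩,
    hd.congr fun z hz => by simp [extZero_eq _ (interior_subset hz)]⟩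

/-- The weighted composition operator `h ↦ w · (h ∘ τ)` on `H(B)`, where `τ` maps `B` into its
interior. -/
def weightedComp {B : Compacts ℂ} (w : HolC B) (τ : ℂ → ℂ) (hc : ContinuousOn τ B)
    (hd : DifferentiableOn ℂ τ (interior (B : Set ℂ)))
    (hm : MapsTo τ B (interior (B : Set ℂ))) : HolC B →L[ℂ] HolC B :=
  LinearMap.mkContinuous
    { toFun := fun h =>
        ⟨w.1 * h.1.comp (⟨fun z : B => (⟨τ z, interior_subset (hm z.2)⟩ : B),
            (hc.comp_continuous continuous_subtype_val fun z => z.2).subtype_mk _⟩ : C(B, B)), by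
          have h1 : DifferentiableOn ℂ (fun z => extZero w.1 z * extZero h.1 (τ z))
              (interior (B : Set ℂ)) :=
            DifferentiableOn.mul w.2
              (DifferentiableOn.comp h.2 hd fun z hz => hm (interior_subset hz))
          refine h1.congr fun z hz => ?_
          have hz' := interior_subset hz
          simp [extZero_eq _ hz', extZero_eq _ (interior_subset (hm hz'))]⟩
      map_add' := by
        intro f g
        ext z
        simp [mul_add]
      map_smul' := by
        intro c f
        ext z
        simp }
    ‖w‖ (by
      intro h
      refine (ContinuousMap.norm_le _ (by positivity)).2 fun z => ?_
      change ‖w.1 z * h.1 ⟨τ z, interior_subset (hm z.2)⟩‖ ≤ ‖w.1‖ * ‖h.1‖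
      rw [norm_mul]
      exact mul_le_mul (w.1.norm_coe_le_norm z) (h.1.norm_coe_le_norm _) (norm_nonneg _)
        (norm_nonneg _))

theorem weightedComp_apply {B : Compacts ℂ} (w : HolC B) (τ : ℂ → ℂ) (hc : ContinuousOn τ B)
    (hd : DifferentiableOn ℂ τ (interior (B : Set ℂ)))
    (hm : MapsTo τ B (interior (B : Set ℂ))) (h : HolC B) (z : B) :
    (weightedComp w τ hc hd hm h).1 z = w.1 z * h.1 ⟨τ z, interior_subset (hm z.2)⟩ := rfl

/-- The operator matrix `(a b; I 0)` acting on pairs. -/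
def companion {E : Type*} [NormedAddCommGroup E] [NormedSpace ℂ E] (a b : E →L[ℂ] E) :
    (E × E) →L[ℂ] (E × E) :=
  (a.comp (ContinuousLinearMap.fst ℂ E E) + b.comp (ContinuousLinearMap.snd ℂ E E)).prod
    (ContinuousLinearMap.fst ℂ E E)

section Maps

variable {k : ℕ} {lam : ℝ} {D : Set ℂ} {η : ℂ → ℂ} {B : Compacts ℂ}

theorem IsDomainK.differentiableAt_phi (hB : IsDomainK lam D η B)
    (hη : IsUniversalPair k lam D η) {z : ℂ} (hz : z ∈ B) :
    DifferentiableAt ℂ (phiMap lam η) z := by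
  have h1 : DifferentiableAt ℂ η ((lam : ℂ) ^ 2 * z) :=
    hη.holomorphic.differentiableAt
      (hη.isOpen.mem_nhds (hB.subset (interior_subset (hB.mapsTo_mul hz))))
  exact (DifferentiableAt.comp z h1 (differentiableAt_id.const_mul _)).const_mul _

theorem IsDomainKHat.differentiableAt_psi (hB : IsDomainKHat lam D η B)
    (hη : IsUniversalPair k lam D η) {z : ℂ} (hz : z ∈ B) :
    DifferentiableAt ℂ (psiMap lam η) z := by
  have h1 : DifferentiableAt ℂ η ((lam : ℂ) * z) :=
    hη.holomorphic.differentiableAt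
      (hη.isOpen.mem_nhds (hB.subset (interior_subset (hB.mapsTo_mul hz))))
  exact (DifferentiableAt.comp z h1 (differentiableAt_id.const_mul _)).const_mul _

theorem IsDomainK.differentiableAt_weight (hB : IsDomainK lam D η B)
    (hη : IsUniversalPair k lam D η) (p : ℝ) {z : ℂ} (hz : z ∈ B) :
    DifferentiableAt ℂ (fun z => deriv η (phiMap lam η z) ^ (p : ℂ)) z := by
  have h1 : DifferentiableAt ℂ (deriv η) (phiMap lam η z) :=
    (hη.holomorphic.deriv hη.isOpen).differentiableAt
      (hη.isOpen.mem_nhds (hB.subset (interior_subset (hB.mapsTo_phi hz))))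
  exact (DifferentiableAt.comp z h1 (hB.differentiableAt_phi hη hz)).cpow
    (differentiableAt_const _) (hB.slit z hz)

theorem IsDomainKHat.differentiableAt_weight (hB : IsDomainKHat lam D η B)
    (hη : IsUniversalPair k lam D η) (p : ℝ) {z : ℂ} (hz : z ∈ B) :
    DifferentiableAt ℂ (fun z => deriv η (psiMap lam η z) ^ (p : ℂ)) z := by
  have h1 : DifferentiableAt ℂ (deriv η) (psiMap lam η z) :=
    (hη.holomorphic.deriv hη.isOpen).differentiableAt
      (hη.isOpen.mem_nhds (hB.subset (interior_subset (hB.mapsTo_psi hz))))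
  exact (DifferentiableAt.comp z h1 (hB.differentiableAt_psi hη hz)).cpow
    (differentiableAt_const _) (hB.slit z hz)

/-- `R h (z) = h (lam⁻¹ η (lam² z))`. -/
def opR (hη : IsUniversalPair k lam D η) (hB : IsDomainK lam D η B) : HolC B →L[ℂ] HolC B :=
  weightedComp (HolC.mk (fun _ => 1) continuousOn_const (differentiableOn_const _))
    (phiMap lam η)
    (fun _ hz => (hB.differentiableAt_phi hη hz).continuousAt.continuousWithinAt)
    (fun _ hz => (hB.differentiableAt_phi hη (interior_subset hz)).differentiableWithinAt)
    hB.mapsTo_phi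

/-- `T_p q (z) = [η' (lam⁻¹ η (lam² z))]^p q (lam² z)`. -/
def opT (hη : IsUniversalPair k lam D η) (hB : IsDomainK lam D η B) (p : ℝ) :
    HolC B →L[ℂ] HolC B :=
  weightedComp
    (HolC.mk (fun z => deriv η (phiMap lam η z) ^ (p : ℂ))
      (fun _ hz => (hB.differentiableAt_weight hη p hz).continuousAt.continuousWithinAt)
      (fun _ hz =>
        (hB.differentiableAt_weight hη p (interior_subset hz)).differentiableWithinAt))
    (fun z => (lam : ℂ) ^ 2 * z) (continuous_const.mul continuous_id).continuousOn
    (differentiable_id.const_mul _).differentiableOn hB.mapsTo_mul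

/-- `U_p h (z) = [η' (lam η (lam z))]^p h (lam z)`. -/
def opU (hη : IsUniversalPair k lam D η) (hB : IsDomainKHat lam D η B) (p : ℝ) :
    HolC B →L[ℂ] HolC B :=
  weightedComp
    (HolC.mk (fun z => deriv η (psiMap lam η z) ^ (p : ℂ))
      (fun _ hz => (hB.differentiableAt_weight hη p hz).continuousAt.continuousWithinAt)
      (fun _ hz =>
        (hB.differentiableAt_weight hη p (interior_subset hz)).differentiableWithinAt))
    (fun z => (lam : ℂ) * z) (continuous_const.mul continuous_id).continuousOn
    (differentiable_id.const_mul _).differentiableOn hB.mapsTo_mul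

/-- `P q (z) = q (lam η (lam z))`. -/
def opP (hη : IsUniversalPair k lam D η) (hB : IsDomainKHat lam D η B) :
    HolC B →L[ℂ] HolC B :=
  weightedComp (HolC.mk (fun _ => 1) continuousOn_const (differentiableOn_const _))
    (psiMap lam η)
    (fun _ hz => (hB.differentiableAt_psi hη hz).continuousAt.continuousWithinAt)
    (fun _ hz => (hB.differentiableAt_psi hη (interior_subset hz)).differentiableWithinAt)
    hB.mapsTo_psi

/-- The limiting Lindeberg-Lyapunov operator `K_p = (R T_p; I 0)` on `H(B) × H(B)`. -/
def opK (hη : IsUniversalPair k lam D η) (hB : IsDomainK lam D η B) (p : ℝ) :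
    (HolC B × HolC B) →L[ℂ] (HolC B × HolC B) :=
  companion (opR hη hB) (opT hη hB p)

/-- The limiting Lindeberg-Lyapunov operator `hat K_p = (U_p P; I 0)` on `H(B) × H(B)`. -/
def opKHat (hη : IsUniversalPair k lam D η) (hB : IsDomainKHat lam D η B) (p : ℝ) :
    (HolC B × HolC B) →L[ℂ] (HolC B × HolC B) :=
  companion (opU hη hB p) (opP hη hB)

/-- The spectral radius `ρ_p` of `K_p`. -/
def rhoK (hη : IsUniversalPair k lam D η) (hB : IsDomainK lam D η B) (p : ℝ) : ℝ :=
  (spectralRadius ℂ (opK hη hB p)).toReal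

/-- The spectral radius `hat ρ_p` of `hat K_p`. -/
def rhoKHat (hη : IsUniversalPair k lam D η) (hB : IsDomainKHat lam D η B) (p : ℝ) : ℝ :=
  (spectralRadius ℂ (opKHat hη hB p)).toReal

end Maps

/-- A strictly log-convex function on `s`: positive on `s` with strictly convex logarithm. -/
def StrictLogConvexOn (s : Set ℝ) (f : ℝ → ℝ) : Prop :=
  (∀ x ∈ s, 0 < f x) ∧ StrictConvexOn ℝ s fun x => Real.log (f x)

end

/-! At a real point the iterates of either operator on the pair (1, 0) follow a second order
recursion with positive weights g₁^p (branch s₁, of length one) and g₂^p (branch s₂, of length two).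
The spectral radius is the growth rate of this recursion. `IsBranch.isGrowthRate` makes this
precise: ρ_p is the least r for which some h, bounded and bounded away from zero on B, satisfies
g₁^p h∘s₁ / r + g₂^p h∘s₂ / r² ≤ h, where g₁, g₂ are the moduli of the complex weights. Such an h
dominates the iterates of the operator. Conversely, the branches contract a distance of Carathéodory
type (`exists_contracted_dist`), so the recursion has bounded distortion over all of B
(`exists_fibIter_le`); its generating function is then a supersolution for each r > ρ_p
(`exists_super_of_growth`), and compactness reaches r = ρ_p.

Dividing by h turns the weights into sub-probabilities. Hölder's inequality combines supersolutions
for p₀ and p₁ into one for an intermediate exponent, which gives log-convexity. For strictness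
(`IsGrowthRate.lt_geom`), the normalized products along a single branch behave like (κ₁^p/ρ_p)^n or
(κ₂^p/ρ_p²)^n. If κ₁² ≠ κ₂, these rates cannot agree for both branches at p₀ and p₁; after N steps
the two distributions on words differ uniformly, Hölder loses a definite factor, and the rate can be
lowered. Raising h to a power c ≥ 1 gives ρ_{cp} ≤ ρ_p^c, so log ρ_p / p decreases, strictly because
of strict convexity.

In both operators one branch has weight 1 and the other fixes 0, with weight κ there. The
differentiated fixed point equation and the vanishing of η' to order 2k at 0 give κ ≥ λ^{-4k} for
K_p and κ ≥ λ^{-2k} for the other operator. Hence κ₁² ≠ κ₂, and following a single branch gives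
λ^{2kp} ρ_p ≥ 1; strict decrease of log ρ_p / p makes this inequality strict. -/

noncomputable section

/-! ### The Carathéodory metric and a contracted distance. -/

/-- The infinitesimal Carathéodory metric of a plane domain. -/
def caraMetric (U : Set ℂ) (y : ℂ) : ℝ :=
  sSup ((fun f : ℂ → ℂ => ‖deriv f y‖) '' {f | DifferentiableOn ℂ f U ∧ ∀ z ∈ U, ‖f z‖ ≤ 1})

theorem norm_deriv_le_of_closedBall_subset {U : Set ℂ} {y : ℂ} {r : ℝ} (hr : 0 < r)
    (hU : Metric.closedBall y r ⊆ U) {f : ℂ → ℂ} (hf : DifferentiableOn ℂ f U)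
    (h1 : ∀ z ∈ U, ‖f z‖ ≤ 1) : ‖deriv f y‖ ≤ 1 / r := by
  refine Complex.norm_deriv_le_of_forall_mem_sphere_norm_le hr ?_
    fun z hz => h1 z (hU (Metric.sphere_subset_closedBall hz))
  exact (hf.mono (by rw [closure_ball _ hr.ne']; exact hU)).diffContOnCl

theorem caraMetric_le_inv {U : Set ℂ} {y : ℂ} {r : ℝ} (hr : 0 < r)
    (hU : Metric.closedBall y r ⊆ U) : caraMetric U y ≤ 1 / r := by
  refine csSup_le ⟨_, fun _ => 0, ⟨differentiableOn_const _, by simp⟩, rfl⟩ ?_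
  rintro _ ⟨f, ⟨hf, h1⟩, rfl⟩
  exact norm_deriv_le_of_closedBall_subset hr hU hf h1

theorem exists_closedBall_subset {U : Set ℂ} (hU : IsOpen U) {y : ℂ} (hy : y ∈ U) :
    ∃ r > 0, Metric.closedBall y r ⊆ U :=
  Metric.nhds_basis_closedBall.mem_iff.1 (hU.mem_nhds hy)

theorem norm_deriv_le_caraMetric {U : Set ℂ} (hU : IsOpen U) {y : ℂ} (hy : y ∈ U) {f : ℂ → ℂ}
    (hf : DifferentiableOn ℂ f U) (h1 : ∀ z ∈ U, ‖f z‖ ≤ 1) : ‖deriv f y‖ ≤ caraMetric U y := by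
  obtain ⟨r, hr, hr'⟩ := exists_closedBall_subset hU hy
  refine le_csSup ⟨1 / r, ?_⟩ ⟨f, ⟨hf, h1⟩, rfl⟩
  rintro _ ⟨g, ⟨hg, hg1⟩, rfl⟩
  exact norm_deriv_le_of_closedBall_subset hr hr' hg hg1

theorem caraMetric_nonneg {U : Set ℂ} (hU : IsOpen U) {y : ℂ} (hy : y ∈ U) :
    0 ≤ caraMetric U y :=
  (norm_nonneg _).trans (norm_deriv_le_caraMetric (f := fun _ => 0) hU hy
    (differentiableOn_const _) (by simp))

theorem norm_deriv_le_mul_caraMetric {U : Set ℂ} (hU : IsOpen U) {y : ℂ} (hy : y ∈ U)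
    {f : ℂ → ℂ} (hf : DifferentiableOn ℂ f U) {A : ℝ} (hA : 0 < A) (h1 : ∀ z ∈ U, ‖f z‖ ≤ A) :
    ‖deriv f y‖ ≤ A * caraMetric U y := by
  have h := norm_deriv_le_caraMetric hU hy (f := fun z => (A : ℂ)⁻¹ * f z) (hf.const_mul _) (by
    intro z hz
    rw [norm_mul, norm_inv, Complex.norm_real, Real.norm_of_nonneg hA.le, inv_mul_le_iff₀ hA]
    simpa using h1 z hz)
  rw [deriv_const_mul _ (hf.differentiableAt (hU.mem_nhds hy)), norm_mul, norm_inv,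
    Complex.norm_real, Real.norm_of_nonneg hA.le, inv_mul_le_iff₀ hA] at h
  exact h

/-- A holomorphic self-map with relatively compact image contracts the Carathéodory metric
(Earle and Hamilton). -/
theorem exists_caraMetric_contraction {U L : Set ℂ} (hU : IsOpen U) (hL : IsCompact L)
    (hLU : L ⊆ U) : ∃ θ : ℝ, 0 < θ ∧ θ < 1 ∧ ∀ τ : ℂ → ℂ, DifferentiableOn ℂ τ U →
      MapsTo τ U L → ∀ y ∈ U, caraMetric U (τ y) * ‖deriv τ y‖ ≤ θ * caraMetric U y := by
  obtain ⟨δ, hδ, hδU⟩ := hL.exists_thickening_subset_open hU hLU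
  obtain ⟨R, hR⟩ := hL.isBounded.subset_closedBall 0
  set R' : ℝ := |R| + 1 with hR'
  have hR'0 : 0 < R' := by positivity
  have hRn : ∀ z ∈ L, ‖z‖ ≤ R' := fun z hz => by
    have := hR hz
    rw [mem_closedBall_zero_iff] at this
    linarith [le_abs_self R]
  set ε : ℝ := δ / (4 * R') with hε
  have hε0 : 0 < ε := by positivity
  refine ⟨1 / (1 + ε), by positivity, by rw [div_lt_one (by positivity)]; linarith, ?_⟩
  intro τ hτ hm y hy
  have hτy : DifferentiableAt ℂ τ y := hτ.differentiableAt (hU.mem_nhds hy)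
  -- `σ` pushes `τ` away from the value `τ y`. It still maps `U` into itself, since points move by
  -- at most `ε * 2R' = δ / 2`, but its derivative at `y` carries a factor `1 + ε`. Testing the
  -- metric at `y` with `f ∘ σ` gives the contraction; `ε` depends only on `L` and `U`.
  set σ : ℂ → ℂ := fun z => τ z + (ε : ℂ) * (τ z - τ y) with hσ
  have hσU : MapsTo σ U U := by
    intro z hz
    refine hδU (Metric.mem_thickening_iff.2 ⟨τ z, hm hz, ?_⟩)
    rw [hσ, dist_eq_norm]
    simp only [add_sub_cancel_left, norm_mul, Complex.norm_real, Real.norm_of_nonneg hε0.le]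
    have h1 : ‖τ z - τ y‖ ≤ R' + R' :=
      (norm_sub_le _ _).trans (add_le_add (hRn _ (hm hz)) (hRn _ (hm hy)))
    calc ε * ‖τ z - τ y‖ ≤ ε * (R' + R') := by gcongr
      _ = δ / 2 := by rw [hε]; field_simp; ring
      _ < δ := by linarith
  have hσd : DifferentiableOn ℂ σ U := hτ.add ((hτ.sub_const _).const_mul _)
  have hσy : σ y = τ y := by simp [hσ]
  have hderσ : HasDerivAt σ (deriv τ y + (ε : ℂ) * deriv τ y) y :=
    hτy.hasDerivAt.add ((hτy.hasDerivAt.sub_const _).const_mul _)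
  have key : ∀ f : ℂ → ℂ, DifferentiableOn ℂ f U → (∀ z ∈ U, ‖f z‖ ≤ 1) →
      (1 + ε) * (‖deriv f (τ y)‖ * ‖deriv τ y‖) ≤ caraMetric U y := by
    intro f hf h1
    have h2 := norm_deriv_le_caraMetric hU hy (f := f ∘ σ) (hf.comp hσd hσU)
      fun z hz => h1 _ (hσU hz)
    have hfy : HasDerivAt f (deriv f (τ y)) (σ y) := by
      rw [hσy]
      exact (hf.differentiableAt (hU.mem_nhds (hLU (hm hy)))).hasDerivAt
    rw [(hfy.comp y hderσ).deriv] at h2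
    refine le_of_eq_of_le ?_ h2
    have : deriv τ y + (ε : ℂ) * deriv τ y = ((1 + ε : ℝ) : ℂ) * deriv τ y := by push_cast; ring
    rw [this, norm_mul, norm_mul, Complex.norm_real, Real.norm_of_nonneg (by positivity)]
    ring
  rw [one_div, ← div_eq_inv_mul, le_div_iff₀ (by positivity)]
  rcases (norm_nonneg (deriv τ y)).eq_or_lt with h0 | h0
  · rw [← h0]; simpa using caraMetric_nonneg hU hy
  have : caraMetric U (τ y) ≤ caraMetric U y / ((1 + ε) * ‖deriv τ y‖) := by
    refine csSup_le ⟨_, fun _ => 0, ⟨differentiableOn_const _, by simp⟩, rfl⟩ ?_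
    rintro _ ⟨f, ⟨hf, h1⟩, rfl⟩
    rw [le_div_iff₀ (by positivity)]
    linarith [key f hf h1]
  rw [le_div_iff₀ (by positivity)] at this
  linarith

/-- Holomorphic functions that do not expand the Carathéodory metric. -/
def caraLip (U : Set ℂ) : Set (ℂ → ℂ) :=
  {F | DifferentiableOn ℂ F U ∧ ∀ z ∈ U, ‖deriv F z‖ ≤ caraMetric U z}

/-- Halving the radius leaves every point of the small ball a disc of radius `r / 2` inside `U`, so
the Cauchy estimate is a Lipschitz bound common to all `F`. -/
theorem exists_ball_caraLip {U : Set ℂ} (hU : IsOpen U) {c : ℂ} (hc : c ∈ U) :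
    ∃ r > 0, ∀ F ∈ caraLip U, ∀ z ∈ Metric.ball c r, ‖F z - F c‖ ≤ 1 := by
  obtain ⟨r, hr, hrU⟩ := exists_closedBall_subset hU hc
  refine ⟨r / 2, by positivity, fun F hF z hz => ?_⟩
  have hsub : ∀ w ∈ Metric.ball c (r / 2), Metric.closedBall w (r / 2) ⊆ U := fun w hw =>
    (Metric.closedBall_subset_closedBall' (by linarith [Metric.mem_ball.1 hw])).trans hrU
  have hmem : ∀ w ∈ Metric.ball c (r / 2), w ∈ U := fun w hw =>
    hsub w hw (Metric.mem_closedBall_self (by positivity))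
  have h := (convex_ball c (r / 2)).norm_image_sub_le_of_norm_deriv_le (𝕜 := ℂ) (f := F)
    (C := 1 / (r / 2))
    (fun w hw => hF.1.differentiableAt (hU.mem_nhds (hmem w hw)))
    (fun w hw => (hF.2 w (hmem w hw)).trans (caraMetric_le_inv (by positivity) (hsub w hw)))
    (Metric.mem_ball_self (by positivity)) hz
  have h2 : ‖z - c‖ ≤ r / 2 := by rw [← dist_eq_norm]; exact (Metric.mem_ball.1 hz).le
  calc _ ≤ 1 / (r / 2) * ‖z - c‖ := h
    _ ≤ 1 / (r / 2) * (r / 2) := by gcongr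
    _ = 1 := by field_simp

/-- Having a bound uniform in `F` is an equivalence relation on `U` with open classes, so
connectedness leaves a single class. This makes `caraDist` finite. -/
theorem exists_bound_caraLip {U : Set ℂ} (hU : IsOpen U) (hc : IsPreconnected U) {x y : ℂ}
    (hx : x ∈ U) (hy : y ∈ U) : ∃ C : ℝ, ∀ F ∈ caraLip U, ‖F x - F y‖ ≤ C := by
  refine hc.induction₂ (fun x y => ∃ C : ℝ, ∀ F ∈ caraLip U, ‖F x - F y‖ ≤ C) ?_ ?_ ?_ hx hy
  · intro c hc
    obtain ⟨r, hr, h⟩ := exists_ball_caraLip hU hc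
    filter_upwards [nhdsWithin_le_nhds (Metric.ball_mem_nhds c hr)] with z hz
    exact ⟨1, fun F hF => by rw [norm_sub_rev]; exact h F hF z hz⟩
  · rintro a b c - - - ⟨C, hC⟩ ⟨C', hC'⟩
    refine ⟨C + C', fun F hF => ?_⟩
    calc ‖F a - F c‖ = ‖(F a - F b) + (F b - F c)‖ := by ring_nf
      _ ≤ _ := (norm_add_le _ _).trans (add_le_add (hC F hF) (hC' F hF))
  · rintro a b - - ⟨C, hC⟩
    exact ⟨C, fun F hF => by rw [norm_sub_rev]; exact hC F hF⟩

theorem exists_bound_caraLip_compact {U L : Set ℂ} (hU : IsOpen U) (hc : IsPreconnected U)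
    (hL : IsCompact L) (hLU : L ⊆ U) :
    ∃ D : ℝ, ∀ x ∈ L, ∀ y ∈ L, ∀ F ∈ caraLip U, ‖F x - F y‖ ≤ D := by
  rcases L.eq_empty_or_nonempty with rfl | ⟨x₀, hx₀⟩
  · exact ⟨0, by simp⟩
  have : ∃ D : ℝ, ∀ x ∈ L, ∀ F ∈ caraLip U, ‖F x - F x₀‖ ≤ D := by
    refine hL.induction_on (p := fun S => ∃ D : ℝ, ∀ x ∈ S, ∀ F ∈ caraLip U, ‖F x - F x₀‖ ≤ D)
      ⟨0, by simp⟩ ?_ ?_ ?_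
    · rintro s t hst ⟨D, hD⟩
      exact ⟨D, fun x hx => hD x (hst hx)⟩
    · rintro s t ⟨D, hD⟩ ⟨D', hD'⟩
      refine ⟨max D D', fun x hx F hF => ?_⟩
      rcases hx with hx | hx
      · exact (hD x hx F hF).trans (le_max_left _ _)
      · exact (hD' x hx F hF).trans (le_max_right _ _)
    · intro c hcL
      obtain ⟨r, hr, h⟩ := exists_ball_caraLip hU (hLU hcL)
      obtain ⟨C, hC⟩ := exists_bound_caraLip hU hc (hLU hcL) (hLU hx₀)
      refine ⟨_, nhdsWithin_le_nhds (Metric.ball_mem_nhds c hr), 1 + C, fun z hz F hF => ?_⟩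
      calc ‖F z - F x₀‖ = ‖(F z - F c) + (F c - F x₀)‖ := by ring_nf
        _ ≤ _ := (norm_add_le _ _).trans (add_le_add (h F hF z hz) (hC F hF))
  obtain ⟨D, hD⟩ := this
  refine ⟨D + D, fun x hx y hy F hF => ?_⟩
  calc ‖F x - F y‖ = ‖(F x - F x₀) - (F y - F x₀)‖ := by ring_nf
    _ ≤ _ := (norm_sub_le _ _).trans (add_le_add (hD x hx F hF) (hD y hy F hF))

/-- The distance attached to the Carathéodory metric by duality. -/
def caraDist (U : Set ℂ) (x y : ℂ) : ℝ :=
  sSup ((fun F : ℂ → ℂ => ‖F x - F y‖) '' caraLip U)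

section

variable {U : Set ℂ}

theorem zero_mem_caraLip (hU : IsOpen U) : (fun _ => (0 : ℂ)) ∈ caraLip U :=
  ⟨differentiableOn_const _, fun z hz => by simpa using caraMetric_nonneg hU hz⟩

theorem le_caraDist (hU : IsOpen U) (hc : IsPreconnected U) {x y : ℂ} (hx : x ∈ U) (hy : y ∈ U)
    {F : ℂ → ℂ} (hF : F ∈ caraLip U) : ‖F x - F y‖ ≤ caraDist U x y := by
  obtain ⟨C, hC⟩ := exists_bound_caraLip hU hc hx hy
  refine le_csSup ⟨C, ?_⟩ ⟨F, hF, rfl⟩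
  rintro _ ⟨G, hG, rfl⟩
  exact hC G hG

theorem caraDist_nonneg (hU : IsOpen U) (hc : IsPreconnected U) {x y : ℂ} (hx : x ∈ U)
    (hy : y ∈ U) : 0 ≤ caraDist U x y :=
  (norm_nonneg _).trans (le_caraDist hU hc hx hy (zero_mem_caraLip hU))

theorem caraDist_le (hU : IsOpen U) {x y : ℂ} {D : ℝ}
    (h : ∀ F ∈ caraLip U, ‖F x - F y‖ ≤ D) : caraDist U x y ≤ D := by
  refine csSup_le ⟨_, _, zero_mem_caraLip hU, rfl⟩ ?_
  rintro _ ⟨G, hG, rfl⟩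
  exact h G hG

theorem norm_sub_le_mul_caraDist (hU : IsOpen U) (hc : IsPreconnected U) {x y : ℂ} (hx : x ∈ U)
    (hy : y ∈ U) {F : ℂ → ℂ} (hF : DifferentiableOn ℂ F U) {A : ℝ} (hA : 0 < A)
    (hd : ∀ z ∈ U, ‖deriv F z‖ ≤ A * caraMetric U z) : ‖F x - F y‖ ≤ A * caraDist U x y := by
  have h := le_caraDist hU hc hx hy (F := fun z => (A : ℂ)⁻¹ * F z) ⟨hF.const_mul _, by
    intro z hz
    rw [deriv_const_mul _ (hF.differentiableAt (hU.mem_nhds hz)), norm_mul, norm_inv,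
      Complex.norm_real, Real.norm_of_nonneg hA.le, inv_mul_le_iff₀ hA]
    exact hd z hz⟩
  rwa [← mul_sub, norm_mul, norm_inv, Complex.norm_real, Real.norm_of_nonneg hA.le,
    inv_mul_le_iff₀ hA] at h

end

/-- Holomorphic self-maps with image in a fixed compact set contract a distance that is bounded
on that compact set and controls all bounded holomorphic functions. -/
theorem exists_contracted_dist {U L : Set ℂ} (hU : IsOpen U) (hc : IsPreconnected U)
    (hL : IsCompact L) (hLU : L ⊆ U) :
    ∃ (d : ℂ → ℂ → ℝ) (θ D : ℝ), 0 < θ ∧ θ < 1 ∧ (∀ x ∈ U, ∀ y ∈ U, 0 ≤ d x y) ∧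
      (∀ x ∈ L, ∀ y ∈ L, d x y ≤ D) ∧
      (∀ τ : ℂ → ℂ, DifferentiableOn ℂ τ U → MapsTo τ U L →
        ∀ x ∈ U, ∀ y ∈ U, d (τ x) (τ y) ≤ θ * d x y) ∧
      ∀ (f : ℂ → ℂ) (A : ℝ), DifferentiableOn ℂ f U → 0 < A → (∀ z ∈ U, ‖f z‖ ≤ A) →
        ∀ x ∈ U, ∀ y ∈ U, ‖f x - f y‖ ≤ A * d x y := by
  obtain ⟨θ, h0, h1, hθ⟩ := exists_caraMetric_contraction hU hL hLU
  obtain ⟨D, hD⟩ := exists_bound_caraLip_compact hU hc hL hLU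
  refine ⟨caraDist U, θ, D, h0, h1, fun x hx y hy => caraDist_nonneg hU hc hx hy,
    fun x hx y hy => caraDist_le hU (hD x hx y hy), ?_, ?_⟩
  · intro τ hτ hm x hx y hy
    refine caraDist_le hU fun F hF => ?_
    -- The test functions are stable under `F ↦ θ⁻¹ F ∘ τ`, so duality passes the contraction from
    -- the metric to the distance without integrating along curves.
    refine norm_sub_le_mul_caraDist hU hc hx hy (F := F ∘ τ)
      (hF.1.comp hτ fun z hz => hLU (hm hz)) h0 fun z hz => ?_
    rw [deriv_comp _ (hF.1.differentiableAt (hU.mem_nhds (hLU (hm hz))))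
      (hτ.differentiableAt (hU.mem_nhds hz)), norm_mul]
    exact (mul_le_mul_of_nonneg_right (hF.2 _ (hLU (hm hz))) (norm_nonneg _)).trans
      (hθ τ hτ hm z hz)
  · intro f A hf hA hfA x hx y hy
    exact norm_sub_le_mul_caraDist hU hc hx hy hf hA
      fun z hz => norm_deriv_le_mul_caraMetric hU hz hf hA hfA

/-! ### Affinity of two-point distributions. -/

theorem strictConcave_geom_mean {t a b : ℝ} (h0 : 0 < t) (h1 : t < 1) (ha : 0 ≤ a) (hb : 0 ≤ b)
    (hab : a ≠ b) : a ^ (1 - t) * b ^ t < (1 - t) * a + t * b := by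
  rcases ha.eq_or_lt with rfl | ha
  · rw [Real.zero_rpow (by linarith), zero_mul, mul_zero, zero_add]
    exact mul_pos h0 (lt_of_le_of_ne hb hab)
  rcases hb.eq_or_lt with rfl | hb
  · rw [Real.zero_rpow (by linarith), mul_zero, mul_zero, add_zero]
    exact mul_pos (by linarith) ha
  have h := strictConcaveOn_log_Ioi.2 (mem_Ioi.2 ha) (mem_Ioi.2 hb) hab
    (show 0 < 1 - t by linarith) h0 (by ring)
  rw [Real.rpow_def_of_pos ha, Real.rpow_def_of_pos hb, ← Real.exp_add,
    ← Real.lt_log_iff_exp_lt (by have := mul_pos h0 hb; nlinarith)]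
  simp only [smul_eq_mul] at h
  linarith

/-- The two-point affinity of the pairs `(a, 1 - a)` and `(b, 1 - b)`. -/
def affinity (t a b : ℝ) : ℝ := a ^ (1 - t) * b ^ t + (1 - a) ^ (1 - t) * (1 - b) ^ t

theorem affinity_lt_one {t a b : ℝ} (h0 : 0 < t) (h1 : t < 1) (ha : a ∈ Icc (0 : ℝ) 1)
    (hb : b ∈ Icc (0 : ℝ) 1) (hab : a ≠ b) : affinity t a b < 1 := by
  have e1 := strictConcave_geom_mean h0 h1 ha.1 hb.1 hab
  have e2 := strictConcave_geom_mean h0 h1 (a := 1 - a) (b := 1 - b) (by linarith [ha.2])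
    (by linarith [hb.2]) (fun h => hab (by linarith))
  unfold affinity
  linarith

/-- Compactness of the set of separated pairs. The bound `δ` excludes `a = b = 0`, which satisfies
the ratio condition and has affinity one. -/
theorem exists_affinity_le {t δ : ℝ} (h0 : 0 < t) (h1 : t < 1) (hδ : 0 < δ) :
    ∃ ε > 0, ε < 1 ∧ ∀ a ∈ Icc δ 1, ∀ b ∈ Icc δ 1, (2 * b ≤ a ∨ 2 * a ≤ b) →
      affinity t a b ≤ 1 - ε := by
  set S : Set (ℝ × ℝ) := (Icc δ 1 ×ˢ Icc δ 1) ∩ {z | 2 * z.2 ≤ z.1 ∨ 2 * z.1 ≤ z.2} with hS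
  have hSc : IsCompact S := by
    refine (isCompact_Icc.prod isCompact_Icc).inter_right (IsClosed.union ?_ ?_)
    · exact isClosed_le (continuous_const.mul continuous_snd) continuous_fst
    · exact isClosed_le (continuous_const.mul continuous_fst) continuous_snd
  have hcont : Continuous fun z : ℝ × ℝ => affinity t z.1 z.2 := by
    unfold affinity
    refine ((continuous_fst.rpow_const fun _ => Or.inr (by linarith)).mul
      (continuous_snd.rpow_const fun _ => Or.inr h0.le)).add
      (((continuous_const.sub continuous_fst).rpow_const fun _ => Or.inr (by linarith)).mul
      ((continuous_const.sub continuous_snd).rpow_const fun _ => Or.inr h0.le))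
  rcases S.eq_empty_or_nonempty with he | hne
  · refine ⟨1 / 2, by norm_num, by norm_num, fun a ha b hb hab => ?_⟩
    have : (a, b) ∈ S := ⟨⟨ha, hb⟩, hab⟩
    rw [he] at this
    exact this.elim
  obtain ⟨z, hz, hmax⟩ := hSc.exists_isMaxOn hne hcont.continuousOn
  have hlt : affinity t z.1 z.2 < 1 := by
    obtain ⟨⟨h1', h2'⟩, h3⟩ := hz
    refine affinity_lt_one h0 h1 ⟨hδ.le.trans h1'.1, h1'.2⟩ ⟨hδ.le.trans h2'.1, h2'.2⟩ ?_
    intro h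
    rcases h3 with h3 | h3
    · linarith [h2'.1]
    · linarith [h1'.1]
  have hnn : 0 ≤ affinity t z.1 z.2 := by
    obtain ⟨⟨h1', h2'⟩, h3⟩ := hz
    exact add_nonneg (mul_nonneg (Real.rpow_nonneg (hδ.le.trans h1'.1) _)
      (Real.rpow_nonneg (hδ.le.trans h2'.1) _)) (mul_nonneg
        (Real.rpow_nonneg (by linarith [h1'.2]) _) (Real.rpow_nonneg (by linarith [h2'.2]) _))
  refine ⟨(1 - affinity t z.1 z.2) / 2, by linarith, by linarith, fun a ha b hb hab => ?_⟩
  have := hmax (show (a, b) ∈ S from ⟨⟨ha, hb⟩, hab⟩)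
  change affinity t a b ≤ affinity t z.1 z.2 at this
  linarith

theorem exists_ratio_large {α β K : ℝ} (hβ : 0 < β) (hαβ : β < α) (hK : 0 < K) :
    ∃ N : ℕ, 1 ≤ N ∧ 2 * (K * β ^ N) ≤ α ^ N / K := by
  have h := (tendsto_pow_atTop_atTop_of_one_lt ((one_lt_div hβ).2 hαβ)).eventually_ge_atTop
    (2 * K * K)
  obtain ⟨N, h1, h2⟩ := (h.and (Filter.eventually_ge_atTop 1)).exists
  refine ⟨N, h2, ?_⟩
  rw [div_pow, le_div_iff₀ (by positivity)] at h1
  rw [le_div_iff₀ hK]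
  linarith

/-- Different exponential rates eventually beat the comparability constants, so at some time `N` the
two quantities differ by a factor 2 at every `x`. -/
theorem exists_affinity_gap {X : Type*} {a b : ℕ → X → ℝ} {α β K t : ℝ} (hα : 0 < α)
    (hβ : 0 < β) (hK : 0 < K) (h0 : 0 < t) (h1 : t < 1) (hne : α ≠ β)
    (ha : ∀ n x, α ^ n / K ≤ a n x ∧ a n x ≤ K * α ^ n)
    (hb : ∀ n x, β ^ n / K ≤ b n x ∧ b n x ≤ K * β ^ n)
    (ha1 : ∀ n x, a n x ≤ 1) (hb1 : ∀ n x, b n x ≤ 1) :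
    ∃ N : ℕ, 1 ≤ N ∧ ∃ ε > 0, ε < 1 ∧ ∀ x, affinity t (a N x) (b N x) ≤ 1 - ε := by
  have main : ∃ N : ℕ, 1 ≤ N ∧ ∀ x, 2 * b N x ≤ a N x ∨ 2 * a N x ≤ b N x := by
    rcases hne.lt_or_gt with h | h
    · obtain ⟨N, hN, hN'⟩ := exists_ratio_large hα h hK
      exact ⟨N, hN, fun x => Or.inr (by linarith [(ha N x).2, (hb N x).1])⟩
    · obtain ⟨N, hN, hN'⟩ := exists_ratio_large hβ h hK
      exact ⟨N, hN, fun x => Or.inl (by linarith [(hb N x).2, (ha N x).1])⟩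
  obtain ⟨N, hN, hsep⟩ := main
  obtain ⟨ε, hε, hε1, hle⟩ := exists_affinity_le (t := t) (δ := min (α ^ N / K) (β ^ N / K)) h0 h1
    (by positivity)
  exact ⟨N, hN, ε, hε, hε1, fun x => hle _ ⟨(min_le_left _ _).trans (ha N x).1, ha1 N x⟩ _
    ⟨(min_le_right _ _).trans (hb N x).1, hb1 N x⟩ (hsep x)⟩

/-! ### Transfer iterates of geometric means of weights. -/

section Abstract

variable {X : Type*}

/-- The product of a weight along an orbit of length `n`. -/
def orbitProd (s : X → X) (m : X → ℝ) : ℕ → X → ℝ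
  | 0 => fun _ => 1
  | n + 1 => fun x => m x * orbitProd s m n (s x)

/-- The iterates of the constant function under a two-branch transfer operator. -/
def transferIter (s₁ s₂ : X → X) (m₁ m₂ : X → ℝ) : ℕ → X → ℝ
  | 0 => fun _ => 1
  | n + 1 => fun x => m₁ x * transferIter s₁ s₂ m₁ m₂ n (s₁ x) +
      m₂ x * transferIter s₁ s₂ m₁ m₂ n (s₂ x)

theorem orbitProd_pos {s : X → X} {m : X → ℝ} (hm : ∀ x, 0 < m x) (n : ℕ) (x : X) :
    0 < orbitProd s m n x := by
  induction n generalizing x with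
  | zero => exact one_pos
  | succ n ih => exact mul_pos (hm x) (ih _)

theorem orbitProd_le_one {s : X → X} {m : X → ℝ} (hm : ∀ x, 0 < m x) (hm1 : ∀ x, m x ≤ 1)
    (n : ℕ) (x : X) : orbitProd s m n x ≤ 1 := by
  induction n generalizing x with
  | zero => exact le_rfl
  | succ n ih => exact mul_le_one₀ (hm1 x) (orbitProd_pos hm n _).le (ih _)

theorem transferIter_nonneg {s₁ s₂ : X → X} {m₁ m₂ : X → ℝ} (h₁ : ∀ x, 0 < m₁ x)
    (h₂ : ∀ x, 0 < m₂ x) (n : ℕ) (x : X) : 0 ≤ transferIter s₁ s₂ m₁ m₂ n x := by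
  induction n generalizing x with
  | zero => exact zero_le_one
  | succ n ih =>
    exact add_nonneg (mul_nonneg (h₁ x).le (ih _)) (mul_nonneg (h₂ x).le (ih _))

theorem transferIter_swap (s₁ s₂ : X → X) (m₁ m₂ : X → ℝ) (n : ℕ) (x : X) :
    transferIter s₁ s₂ m₁ m₂ n x = transferIter s₂ s₁ m₂ m₁ n x := by
  induction n generalizing x with
  | zero => rfl
  | succ n ih => simp only [transferIter, ih, add_comm]

theorem holder_two {t a b c d : ℝ} (h0 : 0 < t) (h1 : t < 1) (ha : 0 ≤ a) (hb : 0 ≤ b)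
    (hc : 0 ≤ c) (hd : 0 ≤ d) :
    a ^ (1 - t) * b ^ t + c ^ (1 - t) * d ^ t ≤ (a + c) ^ (1 - t) * (b + d) ^ t := by
  rcases (add_nonneg ha hc).eq_or_lt with h | hA
  · have e1 : a = 0 := by linarith
    have e2 : c = 0 := by linarith
    simp [e1, e2, Real.zero_rpow (show 1 - t ≠ 0 by linarith)]
  rcases (add_nonneg hb hd).eq_or_lt with h | hB
  · have e1 : b = 0 := by linarith
    have e2 : d = 0 := by linarith
    simp [e1, e2, Real.zero_rpow h0.ne']
  have e1 := Real.geom_mean_le_arith_mean2_weighted (show 0 ≤ 1 - t by linarith) h0.le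
    (div_nonneg ha hA.le) (div_nonneg hb hB.le) (by ring)
  have e2 := Real.geom_mean_le_arith_mean2_weighted (show 0 ≤ 1 - t by linarith) h0.le
    (div_nonneg hc hA.le) (div_nonneg hd hB.le) (by ring)
  rw [Real.div_rpow ha hA.le, Real.div_rpow hb hB.le] at e1
  rw [Real.div_rpow hc hA.le, Real.div_rpow hd hB.le] at e2
  have hP : 0 < (a + c) ^ (1 - t) := Real.rpow_pos_of_pos hA _
  have hQ : 0 < (b + d) ^ t := Real.rpow_pos_of_pos hB _
  have e3 : (1 - t) * (a / (a + c)) + t * (b / (b + d)) +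
      ((1 - t) * (c / (a + c)) + t * (d / (b + d))) = 1 := by
    field_simp
    ring
  have e4 : a ^ (1 - t) / (a + c) ^ (1 - t) * (b ^ t / (b + d) ^ t) +
      c ^ (1 - t) / (a + c) ^ (1 - t) * (d ^ t / (b + d) ^ t) =
      (a ^ (1 - t) * b ^ t + c ^ (1 - t) * d ^ t) / ((a + c) ^ (1 - t) * (b + d) ^ t) := by
    field_simp
  have e5 : (a ^ (1 - t) * b ^ t + c ^ (1 - t) * d ^ t) / ((a + c) ^ (1 - t) * (b + d) ^ t) ≤ 1 := by
    linarith
  rwa [div_le_one (by positivity)] at e5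

/-- Among the words of length `N`, single out the one using only `s₁` and lump all others together:
by Hölder, lumping can only increase the affinity. The bound by 1 is proved in the same induction
because the `s₂` term uses it. -/
theorem transferIter_le_affinity {s₁ s₂ : X → X} {m₁ m₂ n₁ n₂ : X → ℝ} {t : ℝ} (h0 : 0 < t)
    (h1 : t < 1) (hm₁ : ∀ x, 0 < m₁ x) (hm₂ : ∀ x, 0 < m₂ x) (hn₁ : ∀ x, 0 < n₁ x)
    (hn₂ : ∀ x, 0 < n₂ x) (hm : ∀ x, m₁ x + m₂ x ≤ 1) (hn : ∀ x, n₁ x + n₂ x ≤ 1) (N : ℕ) (x : X) :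
    transferIter s₁ s₂ (fun x => m₁ x ^ (1 - t) * n₁ x ^ t) (fun x => m₂ x ^ (1 - t) * n₂ x ^ t) N x
      ≤ 1 ∧
    transferIter s₁ s₂ (fun x => m₁ x ^ (1 - t) * n₁ x ^ t) (fun x => m₂ x ^ (1 - t) * n₂ x ^ t) N x
      ≤ affinity t (orbitProd s₁ m₁ N x) (orbitProd s₁ n₁ N x) := by
  have hm1 : ∀ x, m₁ x ≤ 1 := fun x => by linarith [hm x, hm₂ x]
  have hn1 : ∀ x, n₁ x ≤ 1 := fun x => by linarith [hn x, hn₂ x]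
  have h1t : 0 < 1 - t := by linarith
  induction N generalizing x with
  | zero =>
    simp [transferIter, affinity, orbitProd, Real.zero_rpow h0.ne']
  | succ N ih =>
    set u := transferIter s₁ s₂ (fun x => m₁ x ^ (1 - t) * n₁ x ^ t)
      (fun x => m₂ x ^ (1 - t) * n₂ x ^ t) with hu
    set a := orbitProd s₁ m₁ N (s₁ x) with ha
    set b := orbitProd s₁ n₁ N (s₁ x) with hb
    have ha0 : 0 < a := orbitProd_pos hm₁ _ _
    have hb0 : 0 < b := orbitProd_pos hn₁ _ _
    have ha1 : a ≤ 1 := orbitProd_le_one hm₁ hm1 _ _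
    have hb1 : b ≤ 1 := orbitProd_le_one hn₁ hn1 _ _
    have hw₁ : 0 < m₁ x ^ (1 - t) * n₁ x ^ t :=
      mul_pos (Real.rpow_pos_of_pos (hm₁ x) _) (Real.rpow_pos_of_pos (hn₁ x) _)
    have hw₂ : 0 < m₂ x ^ (1 - t) * n₂ x ^ t :=
      mul_pos (Real.rpow_pos_of_pos (hm₂ x) _) (Real.rpow_pos_of_pos (hn₂ x) _)
    have hstep : u (N + 1) x = m₁ x ^ (1 - t) * n₁ x ^ t * u N (s₁ x) +
      m₂ x ^ (1 - t) * n₂ x ^ t * u N (s₂ x) := rfl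
    have hrp : ∀ {y z e : ℝ}, 0 ≤ y → y ≤ z → 0 < e → y ^ e ≤ z ^ e :=
      fun hy hyz he => Real.rpow_le_rpow hy hyz he.le
    constructor
    · rw [hstep]
      have hold := holder_two h0 h1 (hm₁ x).le (hn₁ x).le (hm₂ x).le (hn₂ x).le
      have hle : (m₁ x + m₂ x) ^ (1 - t) * (n₁ x + n₂ x) ^ t ≤ 1 :=
        mul_le_one₀ (Real.rpow_le_one (by linarith [hm₁ x, hm₂ x]) (hm x) h1t.le)
          (Real.rpow_nonneg (by linarith [hn₁ x, hn₂ x]) _)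
          (Real.rpow_le_one (by linarith [hn₁ x, hn₂ x]) (hn x) h0.le)
      have := mul_le_mul_of_nonneg_left (ih (s₁ x)).1 hw₁.le
      have := mul_le_mul_of_nonneg_left (ih (s₂ x)).1 hw₂.le
      linarith
    · rw [hstep]
      have e1 := mul_le_mul_of_nonneg_left (ih (s₁ x)).2 hw₁.le
      have e2 := mul_le_mul_of_nonneg_left (ih (s₂ x)).1 hw₂.le
      have hA : orbitProd s₁ m₁ (N + 1) x = m₁ x * a := rfl
      have hB : orbitProd s₁ n₁ (N + 1) x = n₁ x * b := rfl
      -- Merges the two remainders: words that start with `s₁` but leave it later, and words that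
      -- start with `s₂`.
      have hold := holder_two h0 h1 (mul_nonneg (hm₁ x).le (sub_nonneg.2 ha1))
        (mul_nonneg (hn₁ x).le (sub_nonneg.2 hb1)) (hm₂ x).le (hn₂ x).le
      have hmono : (m₁ x * (1 - a) + m₂ x) ^ (1 - t) * (n₁ x * (1 - b) + n₂ x) ^ t ≤
          (1 - m₁ x * a) ^ (1 - t) * (1 - n₁ x * b) ^ t := by
        have p1 : 0 ≤ m₁ x * (1 - a) + m₂ x :=
          add_nonneg (mul_nonneg (hm₁ x).le (sub_nonneg.2 ha1)) (hm₂ x).le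
        have p2 : 0 ≤ n₁ x * (1 - b) + n₂ x :=
          add_nonneg (mul_nonneg (hn₁ x).le (sub_nonneg.2 hb1)) (hn₂ x).le
        have q1 : m₁ x * (1 - a) + m₂ x ≤ 1 - m₁ x * a := by linarith [hm x]
        have q2 : n₁ x * (1 - b) + n₂ x ≤ 1 - n₁ x * b := by linarith [hn x]
        exact mul_le_mul (hrp p1 q1 h1t) (hrp p2 q2 h0) (Real.rpow_nonneg p2 _)
          (Real.rpow_nonneg (p1.trans q1) _)
      rw [hA, hB]
      unfold affinity at e1 ⊢
      rw [Real.mul_rpow (hm₁ x).le (sub_nonneg.2 ha1),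
        Real.mul_rpow (hn₁ x).le (sub_nonneg.2 hb1)] at hold
      rw [Real.mul_rpow (hm₁ x).le ha0.le, Real.mul_rpow (hn₁ x).le hb0.le]
      linarith [e1, e2, hold, hmono]

/-- A gap at step `N` lets one enlarge the weights. -/
theorem exists_enlarged_supersolution {s₁ s₂ : X → X} {m₁ m₂ : X → ℝ} {ε : ℝ} {N : ℕ}
    (hN : 1 ≤ N) (hm₁ : ∀ x, 0 < m₁ x) (hm₂ : ∀ x, 0 < m₂ x) (hε : 0 < ε)
    (hle : ∀ n x, transferIter s₁ s₂ m₁ m₂ n x ≤ 1)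
    (hgap : ∀ x, transferIter s₁ s₂ m₁ m₂ N x ≤ 1 - ε) :
    ∃ q > 1, ∃ (C : ℝ) (f : X → ℝ), (∀ x, 1 ≤ f x ∧ f x ≤ C) ∧
      ∀ x, m₁ x * (q * f (s₁ x)) + m₂ x * (q ^ 2 * f (s₂ x)) ≤ f x := by
  have hq : ∃ q : ℝ, 1 < q ∧ (q ^ 2) ^ N * (1 - ε) < 1 := by
    have hcont : Continuous fun q : ℝ => (q ^ 2) ^ N * (1 - ε) := by fun_prop
    have hev : ∀ᶠ q in 𝓝[>] (1 : ℝ), (q ^ 2) ^ N * (1 - ε) < 1 :=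
      nhdsWithin_le_nhds (hcont.continuousAt.eventually_lt continuousAt_const (by simpa using hε))
    obtain ⟨q, h1, h2⟩ := (hev.and self_mem_nhdsWithin).exists
    exact ⟨q, h2, h1⟩
  obtain ⟨q, hq1, hqN⟩ := hq
  have hq0 : 0 < q := by linarith
  set u := transferIter s₁ s₂ m₁ m₂ with hu
  have hu0 : ∀ n x, 0 ≤ u n x := transferIter_nonneg hm₁ hm₂
  -- `f` is a truncated Neumann series at rate `q ^ 2`. Applying the operator shifts it: the initial
  -- term 1 is lost and the new last term `(q ^ 2) ^ N * u N` is below 1 by the choice of `q`.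
  refine ⟨q, hq1, ∑ j ∈ Finset.range N, (q ^ 2) ^ j, fun x => ∑ j ∈ Finset.range N, (q ^ 2) ^ j * u j x,
    fun x => ⟨?_, ?_⟩, fun x => ?_⟩
  · calc (1 : ℝ) = (q ^ 2) ^ 0 * u 0 x := by simp [hu, transferIter]
      _ ≤ _ := Finset.single_le_sum (f := fun j => (q ^ 2) ^ j * u j x)
        (fun j _ => mul_nonneg (by positivity) (hu0 j x)) (Finset.mem_range.2 hN)
  · refine Finset.sum_le_sum fun j _ => ?_
    exact mul_le_of_le_one_right (by positivity) (hle j x)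
  · have hf0 : ∀ y, 0 ≤ ∑ j ∈ Finset.range N, (q ^ 2) ^ j * u j y := fun y =>
      Finset.sum_nonneg fun j _ => mul_nonneg (by positivity) (hu0 j y)
    -- The length-one branch needs only a factor `q`, so using `q ^ 2` on both branches is enough.
    have hqq : q ≤ q ^ 2 := by nlinarith
    have e1 : m₁ x * (q * ∑ j ∈ Finset.range N, (q ^ 2) ^ j * u j (s₁ x)) ≤
        m₁ x * (q ^ 2 * ∑ j ∈ Finset.range N, (q ^ 2) ^ j * u j (s₁ x)) :=
      mul_le_mul_of_nonneg_left (mul_le_mul_of_nonneg_right hqq (hf0 _)) (hm₁ x).le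
    have e2 : m₁ x * (q ^ 2 * ∑ j ∈ Finset.range N, (q ^ 2) ^ j * u j (s₁ x)) +
        m₂ x * (q ^ 2 * ∑ j ∈ Finset.range N, (q ^ 2) ^ j * u j (s₂ x)) =
        ∑ j ∈ Finset.range N, (q ^ 2) ^ (j + 1) * u (j + 1) x := by
      simp only [Finset.mul_sum]
      rw [← Finset.sum_add_distrib]
      refine Finset.sum_congr rfl fun j _ => ?_
      rw [hu, transferIter]
      ring
    have e3 := Finset.sum_range_succ (fun j => (q ^ 2) ^ j * u j x) N
    rw [Finset.sum_range_succ'] at e3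
    have e4 : (q ^ 2) ^ N * u N x ≤ (q ^ 2) ^ N * (1 - ε) :=
      mul_le_mul_of_nonneg_left (hgap x) (by positivity)
    have e5 : (q ^ 2) ^ 0 * u 0 x = 1 := by simp [hu, transferIter]
    linarith

end Abstract

/-! ### Supersolutions, growth rates, strict log-convexity. -/

section Abstract

variable {X : Type*}

/-- A function that is bounded and bounded away from zero. -/
def IsBoundedPos (h : X → ℝ) : Prop := ∃ c > 0, ∃ C, ∀ x, c ≤ h x ∧ h x ≤ C

theorem IsBoundedPos.pos {h : X → ℝ} (hh : IsBoundedPos h) (x : X) : 0 < h x := by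
  obtain ⟨c, hc, C, h'⟩ := hh
  exact hc.trans_le (h' x).1

theorem IsBoundedPos.rpow {h : X → ℝ} (hh : IsBoundedPos h) {e : ℝ} (he : 0 ≤ e) :
    IsBoundedPos fun x => h x ^ e := by
  obtain ⟨c, hc, C, h'⟩ := hh
  exact ⟨c ^ e, Real.rpow_pos_of_pos hc _, C ^ e, fun x =>
    ⟨Real.rpow_le_rpow hc.le (h' x).1 he, Real.rpow_le_rpow (hc.le.trans (h' x).1) (h' x).2 he⟩⟩

theorem IsBoundedPos.mul {f h : X → ℝ} (hf : IsBoundedPos f) (hh : IsBoundedPos h) :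
    IsBoundedPos fun x => f x * h x := by
  obtain ⟨c, hc, C, h'⟩ := hf
  obtain ⟨d, hd, D, h''⟩ := hh
  exact ⟨c * d, mul_pos hc hd, C * D, fun x =>
    ⟨mul_le_mul (h' x).1 (h'' x).1 hd.le (hc.le.trans (h' x).1),
      mul_le_mul (h' x).2 (h'' x).2 (hd.le.trans (h'' x).1)
        ((hc.le.trans (h' x).1).trans (h' x).2)⟩⟩

/-- Positive supersolutions at rate `r` for the second order recursion with branches `s₁` (of
length one) and `s₂` (of length two), with weights the `p`-th powers of `g₁` and `g₂`. -/
def IsSuper (s₁ s₂ : X → X) (g₁ g₂ : X → ℝ) (p r : ℝ) (h : X → ℝ) : Prop :=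
  IsBoundedPos h ∧ ∀ x, g₁ x ^ p * h (s₁ x) / r + g₂ x ^ p * h (s₂ x) / r ^ 2 ≤ h x

/-- `ρ p` is the least rate that has a positive supersolution with weights `g₁ ^ p`, `g₂ ^ p`. -/
structure IsGrowthRate (s₁ s₂ : X → X) (g₁ g₂ : X → ℝ) (ρ : ℝ → ℝ) : Prop where
  pos₁ : ∀ x, 0 < g₁ x
  pos₂ : ∀ x, 0 < g₂ x
  pos : ∀ p, 0 ≤ p → 0 < ρ p
  exists_super : ∀ p, 0 ≤ p → ∃ h, IsSuper s₁ s₂ g₁ g₂ p (ρ p) h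
  le_of_super : ∀ p, 0 ≤ p → ∀ r, 0 < r → ∀ h, IsSuper s₁ s₂ g₁ g₂ p r h → ρ p ≤ r

/-- The products of `g` along orbits of `s` are comparable to the powers of `κ`. -/
def HasRate (s : X → X) (g : X → ℝ) (κ : ℝ) : Prop :=
  ∃ K > 0, ∀ n x, κ ^ n / K ≤ orbitProd s g n x ∧ orbitProd s g n x ≤ K * κ ^ n

/-- The weight `g ^ p` normalized by the function `h` and the rate `r`. -/
def normWeight (s : X → X) (g : X → ℝ) (p r : ℝ) (h : X → ℝ) (x : X) : ℝ :=
  g x ^ p * h (s x) / (r * h x)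

theorem normWeight_pos {s : X → X} {g : X → ℝ} (hg : ∀ x, 0 < g x) {p r : ℝ} (hr : 0 < r)
    {h : X → ℝ} (hh : ∀ x, 0 < h x) (x : X) : 0 < normWeight s g p r h x :=
  div_pos (mul_pos (Real.rpow_pos_of_pos (hg x) _) (hh _)) (mul_pos hr (hh x))

theorem IsSuper.normWeight_add_le {s₁ s₂ : X → X} {g₁ g₂ : X → ℝ} {p r : ℝ} {h : X → ℝ}
    (hs : IsSuper s₁ s₂ g₁ g₂ p r h) (x : X) :
    normWeight s₁ g₁ p r h x + normWeight s₂ g₂ p (r ^ 2) h x ≤ 1 := by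
  have := hs.2 x
  have hx := hs.1.pos x
  unfold normWeight
  rw [← div_div, ← div_div, ← add_div, div_le_one hx]
  exact this

theorem isSuper_of_normWeight {s₁ s₂ : X → X} {g₁ g₂ : X → ℝ} {p r : ℝ} {h : X → ℝ}
    (hb : IsBoundedPos h)
    (hs : ∀ x, normWeight s₁ g₁ p r h x + normWeight s₂ g₂ p (r ^ 2) h x ≤ 1) :
    IsSuper s₁ s₂ g₁ g₂ p r h := by
  refine ⟨hb, fun x => ?_⟩
  have := hs x
  unfold normWeight at this
  rwa [← div_div, ← div_div, ← add_div, div_le_one (hb.pos x)] at this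

/-- The factors `h (s x) / h x` telescope along the orbit. Only a bounded boundary term remains, so
normalization changes the exponential rate in an explicit way. -/
theorem orbitProd_normWeight {s : X → X} {g : X → ℝ} (hg : ∀ x, 0 < g x) {p r : ℝ} (hr : 0 < r)
    {h : X → ℝ} (hh : ∀ x, 0 < h x) (n : ℕ) (x : X) :
    orbitProd s (normWeight s g p r h) n x =
      orbitProd s g n x ^ p * h (s^[n] x) / (r ^ n * h x) := by
  induction n generalizing x with
  | zero => simp [orbitProd, (hh x).ne']
  | succ n ih =>
    simp only [orbitProd, ih, normWeight, Function.iterate_succ_apply]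
    rw [Real.mul_rpow (hg x).le (orbitProd_pos hg _ _).le]
    have := (hh x).ne'
    have := (hh (s x)).ne'
    field_simp
    ring

theorem HasRate.normWeight {s : X → X} {g : X → ℝ} {κ : ℝ} (hκ : 0 < κ) (hk : HasRate s g κ)
    (hg : ∀ x, 0 < g x) {p r : ℝ} (hp : 0 ≤ p) (hr : 0 < r) {h : X → ℝ} (hh : IsBoundedPos h) :
    HasRate s (normWeight s g p r h) (κ ^ p / r) := by
  have hpos := hh.pos
  obtain ⟨c, hc, C, hcC⟩ := hh
  obtain ⟨K, hK, hk⟩ := hk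
  rcases isEmpty_or_nonempty X with hX | ⟨⟨x₀⟩⟩
  · exact ⟨1, one_pos, fun n x => hX.elim x⟩
  have hC : 0 < C := (hpos x₀).trans_le (hcC x₀).2
  refine ⟨K ^ p * C / c, by positivity, fun n x => ?_⟩
  rw [orbitProd_normWeight hg hr hpos]
  have hpow : (κ ^ p / r) ^ n = (κ ^ n) ^ p / r ^ n := by
    rw [div_pow, ← Real.rpow_natCast (κ ^ p), ← Real.rpow_natCast κ, ← Real.rpow_mul hκ.le,
      ← Real.rpow_mul hκ.le, mul_comm]
  have l1 : (κ ^ n) ^ p / K ^ p ≤ orbitProd s g n x ^ p := by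
    rw [← Real.div_rpow (by positivity) hK.le]
    exact Real.rpow_le_rpow (by positivity) (hk n x).1 hp
  have l2 : orbitProd s g n x ^ p ≤ K ^ p * (κ ^ n) ^ p := by
    rw [← Real.mul_rpow hK.le (by positivity)]
    exact Real.rpow_le_rpow (orbitProd_pos hg _ _).le (hk n x).2 hp
  have hKp : 0 < K ^ p := Real.rpow_pos_of_pos hK _
  have hκp : 0 < (κ ^ n) ^ p := Real.rpow_pos_of_pos (by positivity) _
  have hx := hpos x
  rw [hpow]
  constructor
  · calc (κ ^ n) ^ p / r ^ n / (K ^ p * C / c) = ((κ ^ n) ^ p / K ^ p) * c / (r ^ n * C) := by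
          field_simp
      _ ≤ orbitProd s g n x ^ p * h (s^[n] x) / (r ^ n * h x) := by
          gcongr
          · exact mul_nonneg (Real.rpow_nonneg (orbitProd_pos hg _ _).le _) (hpos _).le
          · exact Real.rpow_nonneg (orbitProd_pos hg _ _).le _
          · exact (hcC _).1
          · exact (hcC _).2
  · calc orbitProd s g n x ^ p * h (s^[n] x) / (r ^ n * h x) ≤
          K ^ p * (κ ^ n) ^ p * C / (r ^ n * c) := by
          gcongr
          · exact (hpos _).le
          · exact (hcC _).2
          · exact (hcC _).1
      _ = K ^ p * C / c * ((κ ^ n) ^ p / r ^ n) := by field_simp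

theorem HasRate.le_one {s : X → X} {m : X → ℝ} {κ : ℝ} [Nonempty X] (hm : ∀ x, 0 < m x)
    (hm1 : ∀ x, m x ≤ 1) (hk : HasRate s m κ) : κ ≤ 1 := by
  by_contra! hlt
  obtain ⟨K, hK, hk⟩ := hk
  obtain ⟨x⟩ := ‹Nonempty X›
  obtain ⟨n, hn⟩ := pow_unbounded_of_one_lt K hlt
  have := (hk n x).1.trans (orbitProd_le_one hm hm1 n x)
  rw [div_le_one hK] at this
  linarith

section GrowthRate

variable {s₁ s₂ : X → X} {g₁ g₂ : X → ℝ} {ρ : ℝ → ℝ} {κ₁ κ₂ : ℝ}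

/-- After normalization the weights lie in (0, 1] and sum to at most 1; powers `c ≥ 1` only decrease
them. -/
theorem IsSuper.rpow {p r : ℝ} {h : X → ℝ} (hs : IsSuper s₁ s₂ g₁ g₂ p r h)
    (hg₁ : ∀ x, 0 < g₁ x) (hg₂ : ∀ x, 0 < g₂ x) (hr : 0 < r) {c : ℝ} (hc : 1 ≤ c) :
    IsSuper s₁ s₂ g₁ g₂ (c * p) (r ^ c) fun x => h x ^ c := by
  have hh := hs.1.pos
  have key : ∀ (s : X → X) (g : X → ℝ) (q : ℝ), (∀ x, 0 < g x) → 0 < q → ∀ x,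
      normWeight s g (c * p) (q ^ c) (fun x => h x ^ c) x = normWeight s g p q h x ^ c := by
    intro s g q hg hq x
    have e : 0 < g x ^ p := Real.rpow_pos_of_pos (hg x) _
    unfold normWeight
    rw [Real.div_rpow (mul_nonneg e.le (hh _).le) (mul_nonneg hq.le (hh _).le),
      Real.mul_rpow e.le (hh _).le, Real.mul_rpow hq.le (hh _).le, ← Real.rpow_mul (hg x).le,
      mul_comm p c]
  refine isSuper_of_normWeight (hs.1.rpow (by linarith)) fun x => ?_
  have e2 : (r ^ c) ^ 2 = (r ^ 2) ^ c := by
    rw [← Real.rpow_natCast, ← Real.rpow_natCast, ← Real.rpow_mul hr.le, ← Real.rpow_mul hr.le,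
      mul_comm]
  rw [e2, key s₁ g₁ r hg₁ hr, key s₂ g₂ (r ^ 2) hg₂ (by positivity)]
  have p1 := normWeight_pos (s := s₁) (p := p) hg₁ hr hh x
  have p2 := normWeight_pos (s := s₂) (p := p) hg₂ (r := r ^ 2) (by positivity) hh x
  have h1 := hs.normWeight_add_le x
  have q1 := Real.rpow_le_rpow_of_exponent_ge p1 (by linarith) hc
  have q2 := Real.rpow_le_rpow_of_exponent_ge p2 (by linarith) hc
  rw [Real.rpow_one] at q1 q2
  linarith

namespace IsGrowthRate

theorem mul_le_rpow (hρ : IsGrowthRate s₁ s₂ g₁ g₂ ρ) {p c : ℝ} (hp : 0 ≤ p) (hc : 1 ≤ c) :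
    ρ (c * p) ≤ ρ p ^ c := by
  obtain ⟨h, hh⟩ := hρ.exists_super p hp
  exact hρ.le_of_super _ (by positivity) _ (Real.rpow_pos_of_pos (hρ.pos p hp) _) _
    (hh.rpow hρ.pos₁ hρ.pos₂ (hρ.pos p hp) hc)

/-- Along `s₁` alone the normalized products have rate `κ₁ ^ p / ρ p` and stay below 1. -/
theorem rate₁_le [Nonempty X] (hρ : IsGrowthRate s₁ s₂ g₁ g₂ ρ) (hκ : 0 < κ₁)
    (hk : HasRate s₁ g₁ κ₁) {p : ℝ} (hp : 0 ≤ p) : κ₁ ^ p ≤ ρ p := by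
  obtain ⟨h, hh⟩ := hρ.exists_super p hp
  have hr := hρ.pos p hp
  have p1 := normWeight_pos (s := s₁) (p := p) hρ.pos₁ hr hh.1.pos
  have p2 := normWeight_pos (s := s₂) (p := p) hρ.pos₂ (r := ρ p ^ 2) (by positivity) hh.1.pos
  have := (hk.normWeight hκ hρ.pos₁ hp hr hh.1).le_one p1
    fun x => by linarith [hh.normWeight_add_le x, p2 x]
  rwa [div_le_one hr] at this

theorem rate₂_le [Nonempty X] (hρ : IsGrowthRate s₁ s₂ g₁ g₂ ρ) (hκ : 0 < κ₂)
    (hk : HasRate s₂ g₂ κ₂) {p : ℝ} (hp : 0 ≤ p) : κ₂ ^ p ≤ ρ p ^ 2 := by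
  obtain ⟨h, hh⟩ := hρ.exists_super p hp
  have hr := hρ.pos p hp
  have p1 := normWeight_pos (s := s₁) (p := p) hρ.pos₁ hr hh.1.pos
  have p2 := normWeight_pos (s := s₂) (p := p) hρ.pos₂ (r := ρ p ^ 2) (by positivity) hh.1.pos
  have := (hk.normWeight hκ hρ.pos₂ hp (by positivity : 0 < ρ p ^ 2) hh.1).le_one p2
    fun x => by linarith [hh.normWeight_add_le x, p1 x]
  rwa [div_le_one (by positivity)] at this

theorem exists_affinity_gap {s : X → X} {m n : X → ℝ} {α β t : ℝ} (hα : 0 < α) (hβ : 0 < β)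
    (hne : α ≠ β) (h0 : 0 < t) (h1 : t < 1) (hm : HasRate s m α) (hn : HasRate s n β)
    (hm0 : ∀ x, 0 < m x) (hn0 : ∀ x, 0 < n x) (hm1 : ∀ x, m x ≤ 1) (hn1 : ∀ x, n x ≤ 1) :
    ∃ N : ℕ, 1 ≤ N ∧ ∃ ε > 0, ε < 1 ∧
      ∀ x, affinity t (orbitProd s m N x) (orbitProd s n N x) ≤ 1 - ε := by
  obtain ⟨K, hK, hm⟩ := hm
  obtain ⟨K', hK', hn⟩ := hn
  refine _root_.exists_affinity_gap (K := K + K') hα hβ (by positivity) h0 h1 hne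
    (fun j x => ⟨le_trans ?_ (hm j x).1, (hm j x).2.trans ?_⟩)
    (fun j x => ⟨le_trans ?_ (hn j x).1, (hn j x).2.trans ?_⟩)
    (orbitProd_le_one hm0 hm1) (orbitProd_le_one hn0 hn1)
  all_goals gcongr; linarith

theorem normWeight_geom {s : X → X} {g : X → ℝ} (hg : ∀ x, 0 < g x) {p₀ p₁ r₀ r₁ t q : ℝ}
    (hr₀ : 0 < r₀) (hr₁ : 0 < r₁) (hq : 0 < q) {h₀ h₁ f : X → ℝ} (hh₀ : ∀ x, 0 < h₀ x)
    (hh₁ : ∀ x, 0 < h₁ x) (hf : ∀ x, 0 < f x) (x : X) :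
    normWeight s g ((1 - t) * p₀ + t * p₁) (r₀ ^ (1 - t) * r₁ ^ t / q)
      (fun x => h₀ x ^ (1 - t) * h₁ x ^ t * f x) x =
    (normWeight s g p₀ r₀ h₀ x ^ (1 - t) * normWeight s g p₁ r₁ h₁ x ^ t) * (q * f (s x)) / f x := by
  have a1 : 0 < g x ^ p₀ := Real.rpow_pos_of_pos (hg x) _
  have a2 : 0 < g x ^ p₁ := Real.rpow_pos_of_pos (hg x) _
  have b1 : 0 < h₀ x ^ (1 - t) := Real.rpow_pos_of_pos (hh₀ x) _
  have b2 : 0 < h₁ x ^ t := Real.rpow_pos_of_pos (hh₁ x) _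
  have c1 : 0 < r₀ ^ (1 - t) := Real.rpow_pos_of_pos hr₀ _
  have c2 : 0 < r₁ ^ t := Real.rpow_pos_of_pos hr₁ _
  have := hf x
  unfold normWeight
  rw [Real.div_rpow (mul_nonneg a1.le (hh₀ _).le) (mul_nonneg hr₀.le (hh₀ _).le),
    Real.div_rpow (mul_nonneg a2.le (hh₁ _).le) (mul_nonneg hr₁.le (hh₁ _).le),
    Real.mul_rpow a1.le (hh₀ _).le, Real.mul_rpow a2.le (hh₁ _).le,
    Real.mul_rpow hr₀.le (hh₀ _).le, Real.mul_rpow hr₁.le (hh₁ _).le,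
    ← Real.rpow_mul (hg x).le, ← Real.rpow_mul (hg x).le, Real.rpow_add (hg x),
    mul_comm p₀, mul_comm p₁]
  field_simp

/-- The product `h₀ ^ (1 - t) * h₁ ^ t` is a supersolution at the geometric mean of the rates. A
correction factor `f`, obtained from a gap in affinity along one of the branches, lowers this rate
by a factor `q > 1`. -/
theorem lt_geom [Nonempty X] (hρ : IsGrowthRate s₁ s₂ g₁ g₂ ρ) (hκ₁ : 0 < κ₁) (hκ₂ : 0 < κ₂)
    (hk₁ : HasRate s₁ g₁ κ₁) (hk₂ : HasRate s₂ g₂ κ₂) (hne : κ₁ ^ 2 ≠ κ₂) {p₀ p₁ t : ℝ}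
    (hp₀ : 0 ≤ p₀) (hp₁ : 0 ≤ p₁) (hpp : p₀ ≠ p₁) (h0 : 0 < t) (h1 : t < 1) :
    ρ ((1 - t) * p₀ + t * p₁) < ρ p₀ ^ (1 - t) * ρ p₁ ^ t := by
  obtain ⟨h₀, hh₀⟩ := hρ.exists_super p₀ hp₀
  obtain ⟨h₁, hh₁⟩ := hρ.exists_super p₁ hp₁
  have hr₀ := hρ.pos p₀ hp₀
  have hr₁ := hρ.pos p₁ hp₁
  have hr₀' : 0 < ρ p₀ ^ 2 := by positivity
  have hr₁' : 0 < ρ p₁ ^ 2 := by positivity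
  set m₁ := normWeight s₁ g₁ p₀ (ρ p₀) h₀ with hm₁
  set m₂ := normWeight s₂ g₂ p₀ (ρ p₀ ^ 2) h₀ with hm₂
  set n₁ := normWeight s₁ g₁ p₁ (ρ p₁) h₁ with hn₁
  set n₂ := normWeight s₂ g₂ p₁ (ρ p₁ ^ 2) h₁ with hn₂
  have pm₁ : ∀ x, 0 < m₁ x := normWeight_pos hρ.pos₁ hr₀ hh₀.1.pos
  have pm₂ : ∀ x, 0 < m₂ x := normWeight_pos hρ.pos₂ hr₀' hh₀.1.pos
  have pn₁ : ∀ x, 0 < n₁ x := normWeight_pos hρ.pos₁ hr₁ hh₁.1.pos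
  have pn₂ : ∀ x, 0 < n₂ x := normWeight_pos hρ.pos₂ hr₁' hh₁.1.pos
  have hm : ∀ x, m₁ x + m₂ x ≤ 1 := hh₀.normWeight_add_le
  have hn : ∀ x, n₁ x + n₂ x ≤ 1 := hh₁.normWeight_add_le
  set w₁ : X → ℝ := fun x => m₁ x ^ (1 - t) * n₁ x ^ t with hw₁
  set w₂ : X → ℝ := fun x => m₂ x ^ (1 - t) * n₂ x ^ t with hw₂
  have pw₁ : ∀ x, 0 < w₁ x := fun x =>
    mul_pos (Real.rpow_pos_of_pos (pm₁ x) _) (Real.rpow_pos_of_pos (pn₁ x) _)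
  have pw₂ : ∀ x, 0 < w₂ x := fun x =>
    mul_pos (Real.rpow_pos_of_pos (pm₂ x) _) (Real.rpow_pos_of_pos (pn₂ x) _)
  -- If both rates agreed, eliminating `ρ` from the logarithms would leave `(p₀ - p₁) * (2 log κ₁ -
  -- log κ₂) = 0`.
  have hor : κ₁ ^ p₀ / ρ p₀ ≠ κ₁ ^ p₁ / ρ p₁ ∨ κ₂ ^ p₀ / ρ p₀ ^ 2 ≠ κ₂ ^ p₁ / ρ p₁ ^ 2 := by
    by_contra! hcon
    obtain ⟨e1, e2⟩ := hcon
    have l1 := congrArg Real.log e1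
    have l2 := congrArg Real.log e2
    rw [Real.log_div (Real.rpow_pos_of_pos hκ₁ _).ne' hr₀.ne',
      Real.log_div (Real.rpow_pos_of_pos hκ₁ _).ne' hr₁.ne', Real.log_rpow hκ₁,
      Real.log_rpow hκ₁] at l1
    rw [Real.log_div (Real.rpow_pos_of_pos hκ₂ _).ne' hr₀'.ne',
      Real.log_div (Real.rpow_pos_of_pos hκ₂ _).ne' hr₁'.ne', Real.log_rpow hκ₂,
      Real.log_rpow hκ₂, Real.log_pow, Real.log_pow] at l2
    push_cast at l2
    have l3 : (p₀ - p₁) * (2 * Real.log κ₁ - Real.log κ₂) = 0 := by linarith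
    rcases mul_eq_zero.1 l3 with h | h
    · exact hpp (by linarith)
    · refine hne (Real.log_injOn_pos (mem_Ioi.2 (by positivity)) (mem_Ioi.2 hκ₂) ?_)
      rw [Real.log_pow]
      push_cast
      linarith
  have hgap : ∃ N : ℕ, 1 ≤ N ∧ ∃ ε > 0, ∀ x, transferIter s₁ s₂ w₁ w₂ N x ≤ 1 - ε := by
    rcases hor with h | h
    · obtain ⟨N, hN, ε, hε, -, hle⟩ := exists_affinity_gap (by positivity) (by positivity) h h0 h1
        (hk₁.normWeight hκ₁ hρ.pos₁ hp₀ hr₀ hh₀.1) (hk₁.normWeight hκ₁ hρ.pos₁ hp₁ hr₁ hh₁.1)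
        pm₁ pn₁ (fun x => by linarith [hm x, pm₂ x]) (fun x => by linarith [hn x, pn₂ x])
      exact ⟨N, hN, ε, hε, fun x =>
        (transferIter_le_affinity h0 h1 pm₁ pm₂ pn₁ pn₂ hm hn N x).2.trans (hle x)⟩
    · obtain ⟨N, hN, ε, hε, -, hle⟩ := exists_affinity_gap (by positivity) (by positivity) h h0 h1
        (hk₂.normWeight hκ₂ hρ.pos₂ hp₀ hr₀' hh₀.1) (hk₂.normWeight hκ₂ hρ.pos₂ hp₁ hr₁' hh₁.1)
        pm₂ pn₂ (fun x => by linarith [hm x, pm₁ x]) (fun x => by linarith [hn x, pn₁ x])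
      refine ⟨N, hN, ε, hε, fun x => ?_⟩
      rw [transferIter_swap]
      exact (transferIter_le_affinity h0 h1 pm₂ pm₁ pn₂ pn₁ (fun x => by linarith [hm x])
        (fun x => by linarith [hn x]) N x).2.trans (hle x)
  obtain ⟨N, hN, ε, hε, hle⟩ := hgap
  obtain ⟨q, hq, C, f, hf, hfq⟩ := exists_enlarged_supersolution hN pw₁ pw₂ hε
    (fun n x => (transferIter_le_affinity h0 h1 pm₁ pm₂ pn₁ pn₂ hm hn n x).1) hle
  have hf0 : ∀ x, 0 < f x := fun x => one_pos.trans_le (hf x).1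
  have hq0 : 0 < q := by linarith
  have hR : 0 < ρ p₀ ^ (1 - t) * ρ p₁ ^ t :=
    mul_pos (Real.rpow_pos_of_pos hr₀ _) (Real.rpow_pos_of_pos hr₁ _)
  refine lt_of_le_of_lt (hρ.le_of_super _ ?_ (ρ p₀ ^ (1 - t) * ρ p₁ ^ t / q) (by positivity)
    (fun x => h₀ x ^ (1 - t) * h₁ x ^ t * f x) ?_) (div_lt_self hR hq)
  · have : 0 < 1 - t := by linarith
    positivity
  · refine isSuper_of_normWeight (((hh₀.1.rpow (by linarith)).mul (hh₁.1.rpow h0.le)).mul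
      ⟨1, one_pos, C, hf⟩) fun x => ?_
    have e : (ρ p₀ ^ (1 - t) * ρ p₁ ^ t / q) ^ 2 =
        (ρ p₀ ^ 2) ^ (1 - t) * (ρ p₁ ^ 2) ^ t / q ^ 2 := by
      rw [div_pow, mul_pow]
      simp only [← Real.rpow_natCast, ← Real.rpow_mul hr₀.le, ← Real.rpow_mul hr₁.le]
      rw [mul_comm (1 - t), mul_comm t]
    rw [e, normWeight_geom hρ.pos₁ hr₀ hr₁ hq0 hh₀.1.pos hh₁.1.pos hf0,
      normWeight_geom hρ.pos₂ hr₀' hr₁' (by positivity) hh₀.1.pos hh₁.1.pos hf0, ← add_div,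
      div_le_one (hf0 x)]
    exact hfq x

theorem strictConvexOn_log [Nonempty X] (hρ : IsGrowthRate s₁ s₂ g₁ g₂ ρ) (hκ₁ : 0 < κ₁)
    (hκ₂ : 0 < κ₂) (hk₁ : HasRate s₁ g₁ κ₁) (hk₂ : HasRate s₂ g₂ κ₂) (hne : κ₁ ^ 2 ≠ κ₂) :
    StrictConvexOn ℝ (Ici 0) fun p => Real.log (ρ p) := by
  refine ⟨convex_Ici 0, fun p₀ hp₀ p₁ hp₁ hpp a b ha hb hab => ?_⟩
  have hr₀ := hρ.pos p₀ hp₀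
  have hr₁ := hρ.pos p₁ hp₁
  have ha' : a = 1 - b := by linarith
  have hlt := hρ.lt_geom hκ₁ hκ₂ hk₁ hk₂ hne hp₀ hp₁ hpp hb (by linarith)
  rw [← ha'] at hlt
  have hmem : 0 < ρ (a * p₀ + b * p₁) :=
    hρ.pos _ (add_nonneg (mul_nonneg ha.le hp₀) (mul_nonneg hb.le hp₁))
  have := Real.log_lt_log hmem hlt
  rwa [Real.log_mul (Real.rpow_pos_of_pos hr₀ _).ne' (Real.rpow_pos_of_pos hr₁ _).ne',
    Real.log_rpow hr₀, Real.log_rpow hr₁] at this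

theorem log_div_antitone (hρ : IsGrowthRate s₁ s₂ g₁ g₂ ρ) {p q : ℝ} (hp : 0 < p) (hpq : p ≤ q) :
    Real.log (ρ q) / q ≤ Real.log (ρ p) / p := by
  have h := hρ.mul_le_rpow hp.le (c := q / p) ((one_le_div hp).2 hpq)
  rw [div_mul_cancel₀ _ hp.ne'] at h
  have hq : 0 < q := hp.trans_le hpq
  have := Real.log_le_log (hρ.pos q hq.le) h
  rw [Real.log_rpow (hρ.pos p hp.le)] at this
  rw [div_le_iff₀ hq]
  calc _ ≤ _ := this
    _ = _ := by ring

/-- Equality at `p < q` puts both points of the graph of `log ρ` on one line through the origin.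
Strict convexity puts the midpoint strictly below that line, contradicting monotonicity between the
midpoint and `q`. -/
theorem strictAntiOn_log_div [Nonempty X] (hρ : IsGrowthRate s₁ s₂ g₁ g₂ ρ) (hκ₁ : 0 < κ₁)
    (hκ₂ : 0 < κ₂) (hk₁ : HasRate s₁ g₁ κ₁) (hk₂ : HasRate s₂ g₂ κ₂) (hne : κ₁ ^ 2 ≠ κ₂) :
    StrictAntiOn (fun p => Real.log (ρ p) / p) (Ioi 0) := by
  intro p hp q hq hpq
  have hp' : 0 < p := hp
  have hq' : 0 < q := hq
  refine lt_of_le_of_ne (hρ.log_div_antitone hp' hpq.le) fun heq => ?_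
  simp only at heq
  have hmid := (hρ.strictConvexOn_log hκ₁ hκ₂ hk₁ hk₂ hne).2 (mem_Ici.2 hp'.le) (mem_Ici.2 hq'.le)
    hpq.ne (show (0 : ℝ) < 1 / 2 by norm_num) (show (0 : ℝ) < 1 / 2 by norm_num) (by norm_num)
  simp only [smul_eq_mul] at hmid
  set m := 1 / 2 * p + 1 / 2 * q with hm
  have hm0 : 0 < m := by positivity
  have hle := hρ.log_div_antitone hm0 (show m ≤ q by linarith)
  have e1 : Real.log (ρ p) = Real.log (ρ p) / p * p := by field_simp
  have e2 : Real.log (ρ q) = Real.log (ρ p) / p * q := by rw [← heq]; field_simp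
  rw [heq, le_div_iff₀ hm0] at hle
  have e3 : Real.log (ρ p) / p * m =
      1 / 2 * (Real.log (ρ p) / p * p) + 1 / 2 * (Real.log (ρ p) / p * q) := by rw [hm]; ring
  linarith

end IsGrowthRate

end GrowthRate

end Abstract

/-! ### Bounded distortion and construction of supersolutions. -/

section Abstract

variable {X : Type*}

/-- The branch `s` with weight `g` contracts the distance `d` on the invariant set `L`, and
`log g` is bounded and Lipschitz for `d`. -/
structure IsContractedBranch (L : Set X) (d : X → X → ℝ) (A θ D : ℝ) (s : X → X) (g : X → ℝ) :
    Prop where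
  A_nonneg : 0 ≤ A
  θ_nonneg : 0 ≤ θ
  θ_lt : θ < 1
  d_nonneg : ∀ x ∈ L, ∀ y ∈ L, 0 ≤ d x y
  d_le : ∀ x ∈ L, ∀ y ∈ L, d x y ≤ D
  mem : ∀ x, s x ∈ L
  contract : ∀ x ∈ L, ∀ y ∈ L, d (s x) (s y) ≤ θ * d x y
  pos : ∀ x, 0 < g x
  lip : ∀ x ∈ L, ∀ y ∈ L, Real.log (g x) ≤ Real.log (g y) + A * d x y
  bdd : ∀ x, |Real.log (g x)| ≤ A

/-- Positive functions whose logarithm is `a`-Lipschitz on `L` for `d`. -/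
def IsLogLip (L : Set X) (d : X → X → ℝ) (a : ℝ) (v : X → ℝ) : Prop :=
  (∀ x, 0 < v x) ∧ ∀ x ∈ L, ∀ y ∈ L, v x ≤ v y * Real.exp (a * d x y)

theorem IsLogLip.add {L : Set X} {d : X → X → ℝ} {a : ℝ} {v w : X → ℝ} (hv : IsLogLip L d a v)
    (hw : IsLogLip L d a w) : IsLogLip L d a fun x => v x + w x :=
  ⟨fun x => add_pos (hv.1 x) (hw.1 x), fun x hx y hy => by
    rw [add_mul]; exact add_le_add (hv.2 x hx y hy) (hw.2 x hx y hy)⟩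

namespace IsContractedBranch

variable {L : Set X} {d : X → X → ℝ} {A θ D : ℝ} {s : X → X} {g : X → ℝ}

theorem isLogLip_one (hb : IsContractedBranch L d A θ D s g) {a : ℝ} (ha : 0 ≤ a) :
    IsLogLip L d a fun _ => 1 :=
  ⟨fun _ => one_pos, fun x hx y hy => by
    rw [one_mul]; exact Real.one_le_exp (mul_nonneg ha (hb.d_nonneg x hx y hy))⟩

/-- The constant is the fixed point of `a ↦ p * A + a * θ`: the weight adds `p * A` and contraction
multiplies by `θ`, so the cone is invariant. -/
theorem rpow_mul_isLogLip (hb : IsContractedBranch L d A θ D s g) {p : ℝ} (hp : 0 ≤ p)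
    {v : X → ℝ} (hv : IsLogLip L d (p * A / (1 - θ)) v) :
    IsLogLip L d (p * A / (1 - θ)) fun x => g x ^ p * v (s x) := by
  refine ⟨fun x => mul_pos (Real.rpow_pos_of_pos (hb.pos x) _) (hv.1 _), fun x hx y hy => ?_⟩
  have hθ : 0 < 1 - θ := by linarith [hb.θ_lt]
  set a := p * A / (1 - θ) with ha
  have ha0 : 0 ≤ a := div_nonneg (mul_nonneg hp hb.A_nonneg) hθ.le
  have ha' : p * A + a * θ = a := by rw [ha]; field_simp; ring
  have e1 : g x ^ p ≤ g y ^ p * Real.exp (p * A * d x y) := by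
    rw [Real.rpow_def_of_pos (hb.pos x), Real.rpow_def_of_pos (hb.pos y), ← Real.exp_add,
      Real.exp_le_exp]
    nlinarith [hb.lip x hx y hy]
  have e2 : v (s x) ≤ v (s y) * Real.exp (a * θ * d x y) := by
    refine (hv.2 _ (hb.mem x) _ (hb.mem y)).trans
      (mul_le_mul_of_nonneg_left (Real.exp_le_exp.2 ?_) (hv.1 _).le)
    rw [mul_assoc]
    exact mul_le_mul_of_nonneg_left (hb.contract x hx y hy) ha0
  calc g x ^ p * v (s x) ≤
        (g y ^ p * Real.exp (p * A * d x y)) * (v (s y) * Real.exp (a * θ * d x y)) :=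
        mul_le_mul e1 e2 (hv.1 _).le
          (mul_nonneg (Real.rpow_nonneg (hb.pos y).le _) (Real.exp_pos _).le)
    _ = g y ^ p * v (s y) * Real.exp ((p * A + a * θ) * d x y) := by
        rw [add_mul, Real.exp_add]; ring
    _ = _ := by rw [ha']

theorem D_nonneg [Nonempty X] (hb : IsContractedBranch L d A θ D s g) : 0 ≤ D := by
  obtain ⟨x⟩ := ‹Nonempty X›
  exact (hb.d_nonneg _ (hb.mem x) _ (hb.mem x)).trans (hb.d_le _ (hb.mem x) _ (hb.mem x))

/-- Log-Lipschitz control holds only on `L`, but one step of `s` lands in `L`, where `d ≤ D`; the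
first weight costs at most `2 * p * A`. Hence the comparison of arbitrary points. -/
theorem rpow_mul_le (hb : IsContractedBranch L d A θ D s g) {p a : ℝ} (hp : 0 ≤ p) (ha : 0 ≤ a)
    {v : X → ℝ} (hv : IsLogLip L d a v) (x y : X) :
    g x ^ p * v (s x) ≤ Real.exp (2 * p * A + a * D) * (g y ^ p * v (s y)) := by
  have e1 : g x ^ p ≤ g y ^ p * Real.exp (2 * p * A) := by
    rw [Real.rpow_def_of_pos (hb.pos x), Real.rpow_def_of_pos (hb.pos y), ← Real.exp_add,
      Real.exp_le_exp]
    nlinarith [(abs_le.1 (hb.bdd x)).2, (abs_le.1 (hb.bdd y)).1]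
  have e2 : v (s x) ≤ v (s y) * Real.exp (a * D) := by
    refine (hv.2 _ (hb.mem x) _ (hb.mem y)).trans
      (mul_le_mul_of_nonneg_left (Real.exp_le_exp.2 ?_) (hv.1 _).le)
    exact mul_le_mul_of_nonneg_left (hb.d_le _ (hb.mem x) _ (hb.mem y)) ha
  calc g x ^ p * v (s x) ≤ (g y ^ p * Real.exp (2 * p * A)) * (v (s y) * Real.exp (a * D)) :=
        mul_le_mul e1 e2 (hv.1 _).le
          (mul_nonneg (Real.rpow_nonneg (hb.pos y).le _) (Real.exp_pos _).le)
    _ = _ := by rw [Real.exp_add]; ring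

theorem exists_orbitProd_le (hb : IsContractedBranch L d A θ D s g) :
    ∃ C > 0, ∀ n x y, orbitProd s g n x ≤ C * orbitProd s g n y := by
  rcases isEmpty_or_nonempty X with hX | hX
  · exact ⟨1, one_pos, fun n x => hX.elim x⟩
  have hθ : 0 < 1 - θ := by linarith [hb.θ_lt]
  have ha0 : 0 ≤ 1 * A / (1 - θ) := div_nonneg (mul_nonneg zero_le_one hb.A_nonneg) hθ.le
  have hcone : ∀ n, IsLogLip L d (1 * A / (1 - θ)) (orbitProd s g n) := by
    intro n
    induction n with
    | zero => exact hb.isLogLip_one ha0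
    | succ n ih => simpa [orbitProd] using hb.rpow_mul_isLogLip zero_le_one ih
  refine ⟨Real.exp (2 * 1 * A + 1 * A / (1 - θ) * D), Real.exp_pos _, fun n x y => ?_⟩
  cases n with
  | zero =>
    simp only [orbitProd, mul_one]
    exact Real.one_le_exp (add_nonneg (by linarith [hb.A_nonneg]) (mul_nonneg ha0 hb.D_nonneg))
  | succ n => simpa [orbitProd] using hb.rpow_mul_le zero_le_one ha0 (hcone n) x y

/-- At the fixed point the orbit product is exactly a power of `g x₀`; distortion carries it to
every other point. -/
theorem hasRate_of_fixed (hb : IsContractedBranch L d A θ D s g) {x₀ : X} (hx₀ : s x₀ = x₀) :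
    HasRate s g (g x₀) := by
  obtain ⟨C, hC, h⟩ := hb.exists_orbitProd_le
  have hpow : ∀ n, orbitProd s g n x₀ = g x₀ ^ n := by
    intro n
    induction n with
    | zero => rfl
    | succ n ih => simp only [orbitProd, hx₀, ih, pow_succ']
  refine ⟨C, hC, fun n x => ⟨?_, ?_⟩⟩
  · rw [div_le_iff₀ hC, ← hpow, mul_comm]
    exact h n x₀ x
  · rw [← hpow]
    exact h n x x₀

theorem hasRate_one (s : X → X) : HasRate s (fun _ => 1) 1 := by
  have : ∀ n x, orbitProd s (fun _ => 1) n x = 1 := by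
    intro n
    induction n with
    | zero => exact fun _ => rfl
    | succ n ih => exact fun x => by simp only [orbitProd, ih, one_mul]
  exact ⟨1, one_pos, fun n x => by simp [this]⟩

end IsContractedBranch

/-- The second order recursion with branches `s₁` (of length one) and `s₂` (of length two). -/
def fibIter (s₁ s₂ : X → X) (m₁ m₂ : X → ℝ) : ℕ → X → ℝ
  | 0 => fun _ => 1
  | 1 => m₁
  | n + 2 => fun x => m₁ x * fibIter s₁ s₂ m₁ m₂ (n + 1) (s₁ x) +
      m₂ x * fibIter s₁ s₂ m₁ m₂ n (s₂ x)

theorem fibIter_pos {s₁ s₂ : X → X} {m₁ m₂ : X → ℝ} (h₁ : ∀ x, 0 < m₁ x) (h₂ : ∀ x, 0 < m₂ x)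
    (n : ℕ) (x : X) : 0 < fibIter s₁ s₂ m₁ m₂ n x := by
  induction n using Nat.twoStepInduction generalizing x with
  | zero => exact one_pos
  | one => exact h₁ x
  | more n ih ih' => exact add_pos (mul_pos (h₁ x) (ih' _)) (mul_pos (h₂ x) (ih _))

theorem pow_le_fibIter {s₁ s₂ : X → X} {m₁ m₂ : X → ℝ} {c : ℝ} (hc : 0 < c)
    (h₁ : ∀ x, c ≤ m₁ x) (h₂ : ∀ x, 0 < m₂ x) (n : ℕ) (x : X) :
    c ^ n ≤ fibIter s₁ s₂ m₁ m₂ n x := by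
  induction n generalizing x with
  | zero => simp [fibIter]
  | succ n ih =>
    cases n with
    | zero => simpa [fibIter] using h₁ x
    | succ n =>
      have e1 := mul_le_mul (h₁ x) (ih (s₁ x)) (by positivity) (hc.le.trans (h₁ x))
      have e2 := mul_pos (h₂ x) (fibIter_pos (s₁ := s₁) (s₂ := s₂)
        (fun x => hc.trans_le (h₁ x)) h₂ n (s₂ x))
      rw [fibIter, pow_succ' c (n + 1)]
      linarith

/-- The invariant cone is closed under sums, so every iterate lies in it with the same constant. -/
theorem exists_fibIter_le {L : Set X} {d : X → X → ℝ} {A θ D : ℝ} {s₁ s₂ : X → X} {g₁ g₂ : X → ℝ}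
    (hb₁ : IsContractedBranch L d A θ D s₁ g₁) (hb₂ : IsContractedBranch L d A θ D s₂ g₂)
    {p : ℝ} (hp : 0 ≤ p) :
    ∃ C > 0, ∀ n x y, fibIter s₁ s₂ (fun x => g₁ x ^ p) (fun x => g₂ x ^ p) n x ≤
      C * fibIter s₁ s₂ (fun x => g₁ x ^ p) (fun x => g₂ x ^ p) n y := by
  rcases isEmpty_or_nonempty X with hX | hX
  · exact ⟨1, one_pos, fun n x => hX.elim x⟩
  have hθ : 0 < 1 - θ := by linarith [hb₁.θ_lt]
  have ha0 : 0 ≤ p * A / (1 - θ) := div_nonneg (mul_nonneg hp hb₁.A_nonneg) hθ.le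
  set a := p * A / (1 - θ) with ha
  have h1 : IsLogLip L d a fun _ => 1 := hb₁.isLogLip_one ha0
  have hcone : ∀ n, IsLogLip L d a
      (fibIter s₁ s₂ (fun x => g₁ x ^ p) (fun x => g₂ x ^ p) n) := by
    intro n
    induction n using Nat.twoStepInduction with
    | zero => exact h1
    | one => simpa [fibIter] using hb₁.rpow_mul_isLogLip hp h1
    | more n ih ih' =>
      exact (hb₁.rpow_mul_isLogLip hp ih').add (hb₂.rpow_mul_isLogLip hp ih)
  refine ⟨Real.exp (2 * p * A + a * D), Real.exp_pos _, fun n x y => ?_⟩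
  match n with
  | 0 =>
    simp only [fibIter, mul_one]
    exact Real.one_le_exp (add_nonneg (mul_nonneg (by linarith) hb₁.A_nonneg)
      (mul_nonneg ha0 hb₁.D_nonneg))
  | 1 => simpa [fibIter] using hb₁.rpow_mul_le hp ha0 h1 x y
  | n + 2 =>
    simp only [fibIter]
    rw [mul_add]
    exact add_le_add (hb₁.rpow_mul_le hp ha0 (hcone _) x y)
      (hb₂.rpow_mul_le hp ha0 (hcone _) x y)

/-- The generating function of the recursion, normalized at a base point, is a supersolution. -/
theorem exists_super_of_growth [Nonempty X] {s₁ s₂ : X → X} {g₁ g₂ : X → ℝ} {p C M σ r : ℝ}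
    (h₁ : ∀ x, 0 < g₁ x) (h₂ : ∀ x, 0 < g₂ x) (hσ : 0 < σ) (hσr : σ < r) (hC : 0 < C)
    (hdist : ∀ n x y, fibIter s₁ s₂ (fun x => g₁ x ^ p) (fun x => g₂ x ^ p) n x ≤
      C * fibIter s₁ s₂ (fun x => g₁ x ^ p) (fun x => g₂ x ^ p) n y)
    (hgrow : ∀ n x, fibIter s₁ s₂ (fun x => g₁ x ^ p) (fun x => g₂ x ^ p) n x ≤ M * σ ^ n) :
    ∃ h : X → ℝ, (∀ x, 1 / C ≤ h x ∧ h x ≤ C) ∧ IsSuper s₁ s₂ g₁ g₂ p r h := by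
  have hr : 0 < r := hσ.trans hσr
  have hm₁ : ∀ x, 0 < g₁ x ^ p := fun x => Real.rpow_pos_of_pos (h₁ x) _
  have hm₂ : ∀ x, 0 < g₂ x ^ p := fun x => Real.rpow_pos_of_pos (h₂ x) _
  set a := fibIter s₁ s₂ (fun x => g₁ x ^ p) (fun x => g₂ x ^ p) with ha
  have hpos : ∀ n x, 0 < a n x := fibIter_pos hm₁ hm₂
  have hsum : ∀ x, Summable fun n => a n x / r ^ n := by
    intro x
    refine Summable.of_nonneg_of_le (fun n => div_nonneg (hpos n x).le (by positivity))
      (fun n => ?_) ((summable_geometric_of_lt_one (by positivity)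
        ((div_lt_one hr).2 hσr)).mul_left M)
    rw [div_pow, ← mul_div_assoc]
    exact div_le_div_of_nonneg_right (hgrow n x) (by positivity)
  set H : X → ℝ := fun x => ∑' n, a n x / r ^ n with hH
  -- The recursion summed over `n`. The term `n = 1` supplies the initial term of `H (s₁ x)`; only
  -- the 1 from `n = 0` is left over, and dropping it gives a supersolution.
  have hHeq : ∀ x, H x = 1 + g₁ x ^ p * H (s₁ x) / r + g₂ x ^ p * H (s₂ x) / r ^ 2 := by
    intro x
    have e0 : ∀ y, H y = 1 + ∑' n, a (n + 1) y / r ^ (n + 1) := by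
      intro y
      rw [hH]
      simp only
      rw [(hsum y).tsum_eq_zero_add]
      simp [ha, fibIter]
    have e1 : ∑' n, a (n + 1) x / r ^ (n + 1) =
        g₁ x ^ p / r + ∑' n, a (n + 2) x / r ^ (n + 2) := by
      rw [((summable_nat_add_iff 1).2 (hsum x)).tsum_eq_zero_add]
      simp [ha, fibIter]
    have e2 : ∑' n, a (n + 2) x / r ^ (n + 2) =
        g₁ x ^ p / r * (∑' n, a (n + 1) (s₁ x) / r ^ (n + 1)) +
          g₂ x ^ p / r ^ 2 * H (s₂ x) := by
      rw [hH]
      simp only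
      rw [← tsum_mul_left, ← tsum_mul_left, ← Summable.tsum_add
        (((summable_nat_add_iff 1).2 (hsum (s₁ x))).mul_left _) ((hsum (s₂ x)).mul_left _)]
      refine tsum_congr fun n => ?_
      rw [ha, fibIter]
      field_simp
      ring
    rw [e0 x, e1, e2]
    have e3 := e0 (s₁ x)
    have e4 : ∑' n, a (n + 1) (s₁ x) / r ^ (n + 1) = H (s₁ x) - 1 := by linarith
    rw [e4]
    field_simp
    ring
  have hH1 : ∀ x, 0 < H x := fun x =>
    (hsum x).tsum_pos (fun n => div_nonneg (hpos n x).le (by positivity)) 0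
      (div_pos (hpos 0 x) (by positivity))
  have hHC : ∀ x y, H x ≤ C * H y := by
    intro x y
    rw [hH]
    simp only
    rw [← tsum_mul_left]
    refine Summable.tsum_le_tsum (fun n => ?_) (hsum x) ((hsum y).mul_left C)
    rw [← mul_div_assoc]
    exact div_le_div_of_nonneg_right (hdist n x y) (by positivity)
  obtain ⟨x₀⟩ := ‹Nonempty X›
  -- `H` itself may blow up as `r` decreases to the growth rate. The quotient is bounded by the
  -- distortion constant, independently of `r`.
  have hb : ∀ x, 1 / C ≤ H x / H x₀ ∧ H x / H x₀ ≤ C := fun x =>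
    ⟨by rw [div_le_div_iff₀ hC (hH1 x₀)]; linarith [hHC x₀ x],
      by rw [div_le_iff₀ (hH1 x₀)]; exact hHC x x₀⟩
  refine ⟨fun x => H x / H x₀, hb, ⟨⟨1 / C, by positivity, C, hb⟩, fun x => ?_⟩⟩
  have e : g₁ x ^ p * (H (s₁ x) / H x₀) / r + g₂ x ^ p * (H (s₂ x) / H x₀) / r ^ 2 =
      (g₁ x ^ p * H (s₁ x) / r + g₂ x ^ p * H (s₂ x) / r ^ 2) / H x₀ := by
    field_simp
  rw [e]
  exact div_le_div_of_nonneg_right (by linarith [hHeq x]) (hH1 x₀).le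

theorem exists_super_of_forall_gt {s₁ s₂ : X → X} {g₁ g₂ : X → ℝ} {p C r₀ : ℝ} (hr₀ : 0 < r₀)
    (hC : 0 < C)
    (H : ∀ r, r₀ < r → ∃ h : X → ℝ, (∀ x, 1 / C ≤ h x ∧ h x ≤ C) ∧ IsSuper s₁ s₂ g₁ g₂ p r h) :
    ∃ h : X → ℝ, IsSuper s₁ s₂ g₁ g₂ p r₀ h := by
  set r : ℕ → ℝ := fun n => r₀ + 1 / ((n : ℝ) + 1) with hr
  have hrgt : ∀ n, r₀ < r n := fun n => by
    have : 0 < 1 / ((n : ℝ) + 1) := by positivity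
    rw [hr]; linarith
  choose h hb hs using fun n => H (r n) (hrgt n)
  -- Pointwise limits along one ultrafilter suffice, since supersolutions carry no continuity
  -- requirement.
  set V : Ultrafilter ℕ := Filter.hyperfilter ℕ with hV
  have hlim : ∀ x, ∃ y ∈ Icc (1 / C) C, Filter.Tendsto (fun n => h n x) V (𝓝 y) := by
    intro x
    obtain ⟨y, hy, hle⟩ := isCompact_Icc.ultrafilter_le_nhds (V.map fun n => h n x)
      (by
        rw [Filter.le_principal_iff]
        exact Filter.mem_map.2 (Filter.univ_mem' fun n => hb n x))
    exact ⟨y, hy, hle⟩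
  choose h' hb' hlim' using hlim
  have hrlim : Filter.Tendsto r V (𝓝 r₀) := by
    have : Filter.Tendsto r Filter.atTop (𝓝 (r₀ + 0)) :=
      tendsto_const_nhds.add tendsto_one_div_add_atTop_nhds_zero_nat
    rw [add_zero] at this
    exact this.mono_left (Nat.hyperfilter_le_atTop)
  refine ⟨h', ⟨1 / C, by positivity, C, hb'⟩, fun x => ?_⟩
  refine le_of_tendsto_of_tendsto' (b := (V : Filter ℕ))
    (Filter.Tendsto.add (((hlim' (s₁ x)).const_mul _).div hrlim hr₀.ne')
    (((hlim' (s₂ x)).const_mul _).div (hrlim.pow 2) (by positivity))) (hlim' x)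
    fun n => (hs n).2 x

end Abstract

/-! ### Spectral radius and norms of powers. -/

theorem clm_pow_succ_apply {E : Type*} [NormedAddCommGroup E] [NormedSpace ℂ E] (T : E →L[ℂ] E)
    (n : ℕ) (f : E) : (T ^ (n + 1)) f = T ((T ^ n) f) := by
  rw [pow_succ']
  rfl

theorem clm_pow_zero_apply {E : Type*} [NormedAddCommGroup E] [NormedSpace ℂ E] (T : E →L[ℂ] E)
    (f : E) : (T ^ 0) f = f := by
  rw [pow_zero]
  rfl

section Spectral

variable {E : Type*} [NormedAddCommGroup E] [NormedSpace ℂ E] [CompleteSpace E]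

theorem tendsto_norm_pow_spectralRadius (T : E →L[ℂ] E) :
    Filter.Tendsto (fun n : ℕ => ENNReal.ofReal (‖T ^ n‖ ^ (1 / n : ℝ))) Filter.atTop
      (𝓝 (spectralRadius ℂ T)) :=
  spectrum.pow_norm_pow_one_div_tendsto_nhds_spectralRadius T

theorem spectralRadius_le_of_norm_pow_le {T : E →L[ℂ] E} {C r : ℝ} (hC : 0 < C) (hr : 0 < r)
    (h : ∀ n : ℕ, ‖T ^ n‖ ≤ C * r ^ n) : spectralRadius ℂ T ≤ ENNReal.ofReal r := by
  have hlim : Filter.Tendsto (fun n : ℕ => ENNReal.ofReal (C ^ (1 / n : ℝ) * r)) Filter.atTop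
      (𝓝 (ENNReal.ofReal r)) := by
    refine ENNReal.tendsto_ofReal ?_
    have : Filter.Tendsto (fun n : ℕ => C ^ (1 / n : ℝ)) Filter.atTop (𝓝 (C ^ (0 : ℝ))) :=
      (Real.continuousAt_const_rpow hC.ne').tendsto.comp tendsto_one_div_atTop_nhds_zero_nat
    simpa using this.mul_const r
  refine le_of_tendsto_of_tendsto (tendsto_norm_pow_spectralRadius T) hlim ?_
  filter_upwards [Filter.eventually_gt_atTop 0] with n hn
  refine ENNReal.ofReal_le_ofReal ?_
  have hn' : (n : ℝ) ≠ 0 := by exact_mod_cast hn.ne'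
  calc ‖T ^ n‖ ^ (1 / n : ℝ) ≤ (C * r ^ n) ^ (1 / n : ℝ) :=
        Real.rpow_le_rpow (norm_nonneg _) (h n) (by positivity)
    _ = C ^ (1 / n : ℝ) * r := by
        rw [Real.mul_rpow hC.le (by positivity), ← Real.rpow_natCast, ← Real.rpow_mul hr.le,
          mul_one_div_cancel hn', Real.rpow_one]

theorem spectralRadius_ne_top (T : E →L[ℂ] E) : spectralRadius ℂ T ≠ ⊤ := by
  refine ne_top_of_le_ne_top ENNReal.ofReal_ne_top
    (spectralRadius_le_of_norm_pow_le (T := T) (C := 1 + ‖(1 : E →L[ℂ] E)‖) (r := ‖T‖ + 1)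
      (by positivity) (by positivity) fun n => ?_)
  induction n with
  | zero => simp
  | succ n ih =>
    rw [pow_succ, pow_succ, ← mul_assoc]
    exact (norm_mul_le _ _).trans (mul_le_mul ih (by linarith) (norm_nonneg _) (by positivity))

/-- Gelfand's formula handles all large powers; the finite sum in the constant absorbs the others.
-/
theorem exists_norm_pow_le {T : E →L[ℂ] E} {r : ℝ} (h : (spectralRadius ℂ T).toReal < r) :
    ∃ C > 0, ∀ n : ℕ, ‖T ^ n‖ ≤ C * r ^ n := by
  have hr : 0 < r := ENNReal.toReal_nonneg.trans_lt h
  have hlt : spectralRadius ℂ T < ENNReal.ofReal r :=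
    (ENNReal.lt_ofReal_iff_toReal_lt (spectralRadius_ne_top T)).2 h
  obtain ⟨N, hN⟩ := Filter.eventually_atTop.1
    ((tendsto_norm_pow_spectralRadius T).eventually_lt_const hlt)
  refine ⟨1 + ∑ j ∈ Finset.range (N + 1), ‖T ^ j‖ / r ^ j, by positivity, fun n => ?_⟩
  rcases Nat.lt_or_ge n (N + 1) with hn | hn
  · have h1 : ‖T ^ n‖ / r ^ n ≤ ∑ j ∈ Finset.range (N + 1), ‖T ^ j‖ / r ^ j :=
      Finset.single_le_sum (f := fun j => ‖T ^ j‖ / r ^ j) (fun j _ => by positivity)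
        (Finset.mem_range.2 hn)
    rw [← div_le_iff₀ (by positivity)]
    linarith
  · have h1 := (ENNReal.ofReal_lt_ofReal_iff hr).1 (hN n (by omega))
    have hn' : (n : ℝ) ≠ 0 := by
      have : n ≠ 0 := by omega
      exact_mod_cast this
    have h2 : ‖T ^ n‖ ≤ r ^ n := by
      have := pow_le_pow_left₀ (Real.rpow_nonneg (norm_nonneg (T ^ n)) (1 / n : ℝ)) h1.le n
      rwa [← Real.rpow_natCast (_ ^ _), ← Real.rpow_mul (norm_nonneg _), one_div_mul_cancel hn',
        Real.rpow_one] at this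
    refine h2.trans (le_mul_of_one_le_left (by positivity) ?_)
    have : 0 ≤ ∑ j ∈ Finset.range (N + 1), ‖T ^ j‖ / r ^ j :=
      Finset.sum_nonneg fun j _ => by positivity
    linarith

end Spectral

/-! ### The space H(B) and companion operators of two branches. -/

theorem isClosed_holC (B : Compacts ℂ) : IsClosed (HolC B : Set C(B, ℂ)) := by
  refine isSeqClosed_iff_isClosed.1 fun u f hu hf => ?_
  have hunif : TendstoUniformlyOn (fun n => extZero (u n)) (extZero f) Filter.atTop
      (interior (B : Set ℂ)) := by
    rw [Metric.tendstoUniformlyOn_iff]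
    intro ε hε
    filter_upwards [Metric.tendsto_nhds.1 hf ε hε] with n hn z hz
    rw [extZero_eq _ (interior_subset hz), extZero_eq _ (interior_subset hz), dist_comm]
    exact (ContinuousMap.dist_apply_le_dist _).trans_lt hn
  exact hunif.tendstoLocallyUniformlyOn.differentiableOn (Filter.Eventually.of_forall hu)
    isOpen_interior

instance completeSpace_holC (B : Compacts ℂ) : CompleteSpace (HolC B) :=
  (isClosed_holC B).completeSpace_coe

/-- A holomorphic branch of a weighted composition system on `B`, real on the real line. -/
structure IsBranch (B : Compacts ℂ) (τ G : ℂ → ℂ) : Prop where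
  mapsTo : MapsTo τ B (interior (B : Set ℂ))
  continuousOn : ContinuousOn τ B
  differentiableOn : DifferentiableOn ℂ τ (interior (B : Set ℂ))
  weight_continuousOn : ContinuousOn G B
  weight_differentiableOn : DifferentiableOn ℂ G (interior (B : Set ℂ))
  slit : ∀ z ∈ B, G z ∈ Complex.slitPlane
  real : ∀ x : ℝ, (τ x).im = 0
  weight_real : ∀ x : ℝ, (x : ℂ) ∈ B → (G x).im = 0

namespace IsBranch

variable {B : Compacts ℂ} {τ G τ₁ τ₂ G₁ G₂ : ℂ → ℂ}

/-- The map of a branch, as a self-map of `B`. -/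
def toMap (h : IsBranch B τ G) (z : B) : B := ⟨τ z, interior_subset (h.mapsTo z.2)⟩

/-- The modulus of the weight of a branch. -/
def weight (_ : IsBranch B τ G) (z : B) : ℝ := ‖G z‖

theorem weight_pos (h : IsBranch B τ G) (z : B) : 0 < h.weight z :=
  norm_pos_iff.2 (Complex.slitPlane_ne_zero (h.slit z z.2))

theorem exists_log_bound (h : IsBranch B τ G) :
    ∃ A : ℝ, ∀ z ∈ B, ‖Complex.log (G z)‖ ≤ A :=
  B.isCompact.exists_bound_of_continuousOn (h.weight_continuousOn.clog h.slit)

/-- Since `G` avoids the slit, `log G` is a bounded holomorphic function, hence Lipschitz for the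
contracted distance, and its real part is the logarithm of the modulus. Taking `L` to contain both
images gives one distance for both branches. -/
theorem exists_isContractedBranch (h₁ : IsBranch B τ₁ G₁) (h₂ : IsBranch B τ₂ G₂)
    (hc : IsPreconnected (interior (B : Set ℂ))) :
    ∃ (L : Set B) (d : B → B → ℝ) (A θ D : ℝ),
      IsContractedBranch L d A θ D h₁.toMap h₁.weight ∧
      IsContractedBranch L d A θ D h₂.toMap h₂.weight := by
  set U : Set ℂ := interior (B : Set ℂ) with hU
  set L : Set ℂ := τ₁ '' B ∪ τ₂ '' B with hL
  have hLc : IsCompact L :=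
    (B.isCompact.image_of_continuousOn h₁.continuousOn).union
      (B.isCompact.image_of_continuousOn h₂.continuousOn)
  have hLU : L ⊆ U := by
    rintro _ (⟨z, hz, rfl⟩ | ⟨z, hz, rfl⟩)
    · exact h₁.mapsTo hz
    · exact h₂.mapsTo hz
  obtain ⟨d, θ, D, hθ0, hθ1, hd0, hdD, hcon, hlip⟩ :=
    exists_contracted_dist isOpen_interior hc hLc hLU
  obtain ⟨A₁, hA₁⟩ := h₁.exists_log_bound
  obtain ⟨A₂, hA₂⟩ := h₂.exists_log_bound
  set A : ℝ := |A₁| + |A₂| + 1 with hA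
  have key : ∀ {τ G : ℂ → ℂ} (h : IsBranch B τ G), (∀ z ∈ B, τ z ∈ L) →
      (∀ z ∈ B, ‖Complex.log (G z)‖ ≤ A) →
      IsContractedBranch {z : B | (z : ℂ) ∈ L} (fun x y => d x y) A θ D h.toMap h.weight := by
    intro τ G h hm hbd
    have hlog : ∀ z : B, Real.log (h.weight z) = (Complex.log (G z)).re := fun z =>
      (Complex.log_re _).symm
    refine ⟨by positivity, hθ0.le, hθ1, fun x hx y hy => hd0 _ (hLU hx) _ (hLU hy),
      fun x hx y hy => hdD _ hx _ hy, fun x => hm _ x.2, fun x hx y hy => ?_, h.weight_pos,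
      fun x hx y hy => ?_, fun x => ?_⟩
    · exact hcon τ h.differentiableOn (fun z hz => hm z (interior_subset hz)) _ (hLU hx) _ (hLU hy)
    · have := hlip (fun z => Complex.log (G z)) A
        (h.weight_differentiableOn.clog fun z hz => h.slit z (interior_subset hz)) (by positivity)
        (fun z hz => hbd z (interior_subset hz)) _ (hLU hx) _ (hLU hy)
      have h3 := (Complex.re_le_norm _).trans this
      rw [Complex.sub_re] at h3
      rw [hlog, hlog]
      linarith
    · rw [hlog]
      exact (Complex.abs_re_le_norm _).trans (hbd x x.2)
  refine ⟨_, _, A, θ, D, key h₁ (fun z hz => Or.inl ⟨z, hz, rfl⟩) fun z hz => ?_,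
    key h₂ (fun z hz => Or.inr ⟨z, hz, rfl⟩) fun z hz => ?_⟩
  · have := hA₁ z hz
    linarith [le_abs_self A₁, abs_nonneg A₂]
  · have := hA₂ z hz
    linarith [le_abs_self A₂, abs_nonneg A₁]

theorem weight_eq_of_real (h : IsBranch B τ G) {x : ℝ} (hx : (x : ℂ) ∈ B) (p : ℝ) :
    G x ^ (p : ℂ) = ((‖G x‖ ^ p : ℝ) : ℂ) := by
  have him := h.weight_real x hx
  have hre : 0 < (G x).re := by
    rcases Complex.mem_slitPlane_iff.1 (h.slit x hx) with h' | h'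
    · exact h'
    · exact absurd him h'
  have e : G x = ((G x).re : ℂ) := Complex.ext (by simp) (by simp [him])
  have e2 : ‖G x‖ = (G x).re := by
    rw [e, Complex.norm_real, Real.norm_of_nonneg (by simpa using hre.le)]
    simp
  rw [e2, Complex.ofReal_cpow hre.le, ← e]

theorem toMap_real (h : IsBranch B τ G) {z : B} (hz : (z : ℂ).im = 0) :
    (h.toMap z : ℂ).im = 0 := by
  have e : (z : ℂ) = ((z : ℂ).re : ℂ) := Complex.ext (by simp) (by simp [hz])
  change (τ z).im = 0
  rw [e]
  exact h.real _

/-- `K p` is the companion operator of the two branches, with weights the `p`-th powers. -/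
def IsCompanionFamily (h₁ : IsBranch B τ₁ G₁) (h₂ : IsBranch B τ₂ G₂)
    (K : ℝ → (HolC B × HolC B) →L[ℂ] (HolC B × HolC B)) : Prop :=
  ∀ p f, (∀ z : B, (K p f).1.1 z =
    G₁ z ^ (p : ℂ) * f.1.1 (h₁.toMap z) + G₂ z ^ (p : ℂ) * f.2.1 (h₂.toMap z)) ∧ (K p f).2 = f.1

section Companion

variable {h₁ : IsBranch B τ₁ G₁} {h₂ : IsBranch B τ₂ G₂}
  {K : ℝ → (HolC B × HolC B) →L[ℂ] (HolC B × HolC B)}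

theorem norm_apply_le (f : HolC B) (z : B) : ‖f.1 z‖ ≤ ‖f‖ := f.1.norm_coe_le_norm z

theorem norm_pair_le {f : HolC B × HolC B} {M : ℝ} (hM : 0 ≤ M) (h1 : ∀ z, ‖f.1.1 z‖ ≤ M)
    (h2 : ∀ z, ‖f.2.1 z‖ ≤ M) : ‖f‖ ≤ M :=
  norm_prod_le_iff.2 ⟨(ContinuousMap.norm_le _ hM).2 h1, (ContinuousMap.norm_le _ hM).2 h2⟩

theorem spectralRadius_le_of_isSuper (hK : IsCompanionFamily h₁ h₂ K) {p r : ℝ} (hr : 0 < r)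
    {h : B → ℝ} (hs : IsSuper h₁.toMap h₂.toMap h₁.weight h₂.weight p r h) :
    (spectralRadius ℂ (K p)).toReal ≤ r := by
  have hpos := hs.1.pos
  obtain ⟨⟨c, hc, C, hcC⟩, hsup⟩ := hs
  -- The second component lags one step behind the first, hence the extra `/ r`. The constant `(1 +
  -- r) / c` makes both bounds hold at `n = 0`.
  have hcomp : ∀ f : HolC B × HolC B, ∀ n : ℕ, ∀ z : B,
      ‖((K p ^ n) f).1.1 z‖ ≤ ‖f‖ * ((1 + r) / c) * r ^ n * h z ∧
      ‖((K p ^ n) f).2.1 z‖ ≤ ‖f‖ * ((1 + r) / c) * r ^ n * h z / r := by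
    intro f n
    induction n with
    | zero =>
      intro z
      have e1 : ‖f.1.1 z‖ ≤ ‖f‖ := (norm_apply_le f.1 z).trans (norm_fst_le f)
      have e2 : ‖f.2.1 z‖ ≤ ‖f‖ := (norm_apply_le f.2 z).trans (norm_snd_le f)
      have e3 : 1 ≤ h z / c := (one_le_div hc).2 (hcC z).1
      have e4 : ‖f‖ * ((1 + r) / c) * r ^ 0 * h z = ‖f‖ * ((1 + r) * (h z / c)) := by
        field_simp
      have e5 : ‖f‖ * ((1 + r) / c) * r ^ 0 * h z / r = ‖f‖ * ((1 + r) / r * (h z / c)) := by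
        field_simp
      refine ⟨?_, ?_⟩
      · rw [e4]
        exact e1.trans (le_mul_of_one_le_right (norm_nonneg _)
          (one_le_mul_of_one_le_of_one_le (by linarith) e3))
      · rw [e5]
        exact e2.trans (le_mul_of_one_le_right (norm_nonneg _)
          (one_le_mul_of_one_le_of_one_le ((one_le_div hr).2 (by linarith)) e3))
    | succ n ih =>
      intro z
      have hstep : (K p ^ (n + 1)) f = K p ((K p ^ n) f) := clm_pow_succ_apply _ _ _
      rw [hstep]
      set M := ‖f‖ * ((1 + r) / c) * r ^ n with hM
      have hM0 : 0 ≤ M := by positivity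
      have hMs : ‖f‖ * ((1 + r) / c) * r ^ (n + 1) = M * r := by rw [hM]; ring
      obtain ⟨k1, k2⟩ := hK p ((K p ^ n) f)
      rw [hMs, k2, k1]
      refine ⟨?_, ?_⟩
      · have a1 : ‖G₁ z ^ (p : ℂ) * ((K p ^ n) f).1.1 (h₁.toMap z)‖ ≤
            h₁.weight z ^ p * (M * h (h₁.toMap z)) := by
          rw [norm_mul, Complex.norm_cpow_real]
          exact mul_le_mul_of_nonneg_left (ih _).1 (Real.rpow_nonneg (norm_nonneg _) _)
        have a2 : ‖G₂ z ^ (p : ℂ) * ((K p ^ n) f).2.1 (h₂.toMap z)‖ ≤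
            h₂.weight z ^ p * (M * h (h₂.toMap z) / r) := by
          rw [norm_mul, Complex.norm_cpow_real]
          exact mul_le_mul_of_nonneg_left (ih _).2 (Real.rpow_nonneg (norm_nonneg _) _)
        calc _ ≤ _ := (norm_add_le _ _).trans (add_le_add a1 a2)
          _ = M * r * (h₁.weight z ^ p * h (h₁.toMap z) / r +
              h₂.weight z ^ p * h (h₂.toMap z) / r ^ 2) := by field_simp
          _ ≤ M * r * h z := mul_le_mul_of_nonneg_left (hsup z) (by positivity)
      · have : M * r * h z / r = M * h z := by field_simp
        rw [this]
        exact (ih z).1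
  have hCnn : ∀ z : B, h z ≤ |C| := fun z => (hcC z).2.trans (le_abs_self C)
  have hnorm : ∀ n : ℕ, ‖K p ^ n‖ ≤ ((1 + r) / c * (|C| + 1) * (1 + 1 / r)) * r ^ n := by
    intro n
    refine ContinuousLinearMap.opNorm_le_bound _ (by positivity) fun f => ?_
    have hM0 : 0 ≤ ‖f‖ * ((1 + r) / c) * r ^ n := by positivity
    have heq : (1 + r) / c * (|C| + 1) * (1 + 1 / r) * r ^ n * ‖f‖ =
        ‖f‖ * ((1 + r) / c) * r ^ n * (|C| + 1) + ‖f‖ * ((1 + r) / c) * r ^ n * (|C| + 1) / r := by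
      ring
    have hle : ∀ z, ‖f‖ * ((1 + r) / c) * r ^ n * h z ≤
        ‖f‖ * ((1 + r) / c) * r ^ n * (|C| + 1) := fun z =>
      mul_le_mul_of_nonneg_left (by linarith [hCnn z]) hM0
    have hp1 : 0 ≤ ‖f‖ * ((1 + r) / c) * r ^ n * (|C| + 1) := by positivity
    refine norm_pair_le (by positivity) (fun z => ?_) fun z => ?_
    · rw [heq]
      exact ((hcomp f n z).1.trans (hle z)).trans (le_add_of_nonneg_right (by positivity))
    · rw [heq]
      exact ((hcomp f n z).2.trans (div_le_div_of_nonneg_right (hle z) hr.le)).trans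
        (le_add_of_nonneg_left hp1)
  have := spectralRadius_le_of_norm_pow_le (by positivity) hr hnorm
  exact ENNReal.toReal_le_of_le_ofReal hr.le this

/-- The pair `(1, 0)` in `H(B) × H(B)`. -/
def onePair (B : Compacts ℂ) : HolC B × HolC B :=
  (HolC.mk (fun _ => 1) continuousOn_const (differentiableOn_const _), 0)

theorem norm_onePair_le : ‖onePair B‖ ≤ 1 :=
  norm_pair_le zero_le_one (fun z => by simp [onePair, HolC.mk]) fun z => by simp [onePair]

/-- Real points stay real under both branches, and the weights are positive there, so complex powers
equal powers of moduli. The zero second component of the starting pair is why `fibIter` is just `m₁`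
at index 1. -/
theorem pow_onePair_apply (hK : IsCompanionFamily h₁ h₂ K) (p : ℝ) (n : ℕ) {z : B}
    (hz : (z : ℂ).im = 0) : ((K p ^ n) (onePair B)).1.1 z =
      ((fibIter h₁.toMap h₂.toMap (fun x => h₁.weight x ^ p) (fun x => h₂.weight x ^ p) n z : ℝ) :
        ℂ) := by
  have hw : ∀ {τ G : ℂ → ℂ} (h : IsBranch B τ G) {z : B}, (z : ℂ).im = 0 →
      G z ^ (p : ℂ) = ((h.weight z ^ p : ℝ) : ℂ) := by
    intro τ G h z hz
    have e : (z : ℂ) = ((z : ℂ).re : ℂ) := Complex.ext (by simp) (by simp [hz])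
    have := h.weight_eq_of_real (x := (z : ℂ).re) (by rw [← e]; exact z.2) p
    rw [← e] at this
    exact this
  have hstep : ∀ n, (K p ^ (n + 1)) (onePair B) = K p ((K p ^ n) (onePair B)) := fun n =>
    clm_pow_succ_apply _ _ _
  induction n using Nat.twoStepInduction generalizing z with
  | zero =>
    rw [clm_pow_zero_apply]
    simp [onePair, HolC.mk, fibIter]
  | one =>
    rw [hstep, (hK p _).1, hw h₁ hz, clm_pow_zero_apply]
    simp [onePair, HolC.mk, fibIter]
  | more n ih ih' =>
    rw [hstep, (hK p _).1, hw h₁ hz, hw h₂ hz, ih' (h₁.toMap_real hz), hstep, (hK p _).2,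
      ih (h₂.toMap_real hz)]
    simp [fibIter]

theorem fibIter_le_norm_pow (hK : IsCompanionFamily h₁ h₂ K) (p : ℝ) (n : ℕ) {z : B}
    (hz : (z : ℂ).im = 0) :
    fibIter h₁.toMap h₂.toMap (fun x => h₁.weight x ^ p) (fun x => h₂.weight x ^ p) n z ≤
      ‖K p ^ n‖ := by
  have e1 : ‖((K p ^ n) (onePair B)).1.1 z‖ ≤ ‖K p ^ n‖ := by
    refine (norm_apply_le _ z).trans ((norm_fst_le _).trans (((K p ^ n).le_opNorm _).trans ?_))
    exact mul_le_of_le_one_right (norm_nonneg _) norm_onePair_le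
  rw [pow_onePair_apply hK p n hz, Complex.norm_real] at e1
  exact (le_abs_self _).trans e1

/-- The spectral radius of the companion operators is the growth rate of the real system. -/
theorem isGrowthRate (hK : IsCompanionFamily h₁ h₂ K)
    (hc : IsPreconnected (interior (B : Set ℂ))) {z₀ : B} (hz₀ : (z₀ : ℂ).im = 0) :
    IsGrowthRate h₁.toMap h₂.toMap h₁.weight h₂.weight
      fun p => (spectralRadius ℂ (K p)).toReal := by
  obtain ⟨L, d, A, θ, D, hb₁, hb₂⟩ := h₁.exists_isContractedBranch h₂ hc
  have : Nonempty B := ⟨z₀⟩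
  have hρpos : ∀ p, 0 ≤ p → 0 < (spectralRadius ℂ (K p)).toReal := by
    intro p hp
    have hlow : ∀ n : ℕ, Real.exp (-(p * A)) ^ n ≤ ‖K p ^ n‖ := fun n => by
      refine (pow_le_fibIter (Real.exp_pos _) (fun x => ?_)
        (fun x => Real.rpow_pos_of_pos (h₂.weight_pos x) _) n z₀).trans
        (fibIter_le_norm_pow hK p n hz₀)
      rw [Real.rpow_def_of_pos (h₁.weight_pos x), Real.exp_le_exp]
      nlinarith [(abs_le.1 (hb₁.bdd x)).1]
    by_contra! hcon
    set c := Real.exp (-(p * A)) with hcdef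
    have hc0 : 0 < c := Real.exp_pos _
    obtain ⟨C, hC, hCn⟩ := exists_norm_pow_le (T := K p) (r := c / 2) (by linarith)
    obtain ⟨n, hn⟩ := pow_unbounded_of_one_lt C (show (1 : ℝ) < 2 by norm_num)
    have h1 := (hlow n).trans (hCn n)
    rw [div_pow, mul_div_assoc', le_div_iff₀ (by positivity), mul_comm] at h1
    have := le_of_mul_le_mul_right h1 (by positivity)
    linarith
  refine ⟨h₁.weight_pos, h₂.weight_pos, hρpos, fun p hp => ?_,
    fun p hp r hr h hs => spectralRadius_le_of_isSuper hK hr hs⟩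
  obtain ⟨C, hC, hdist⟩ := exists_fibIter_le hb₁ hb₂ hp
  refine exists_super_of_forall_gt (hρpos p hp) hC fun r hr => ?_
  obtain ⟨σ, hσ1, hσ2⟩ := exists_between hr
  obtain ⟨M, hM, hMn⟩ := exists_norm_pow_le hσ1
  refine exists_super_of_growth (M := C * M) (σ := σ) h₁.weight_pos h₂.weight_pos
    ((hρpos p hp).trans hσ1) hσ2 hC hdist fun n x => ?_
  -- The operator norm controls `fibIter` only at real points, where no phases occur; distortion
  -- extends the bound from `z₀` to all of `B`.
  calc _ ≤ _ := hdist n x z₀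
    _ ≤ C * (M * σ ^ n) :=
      mul_le_mul_of_nonneg_left ((fibIter_le_norm_pow hK p n hz₀).trans (hMn n)) hC.le
    _ = _ := by ring

end Companion

end IsBranch

/-! ### The critical point and the weight at the origin. -/

/-- A nonnegative function with `e x = q x * e (μ x)` that vanishes to order `m` at the origin
without vanishing identically near it forces `q 0 ≥ |μ|⁻ᵐ`. -/
theorem one_le_abs_pow_mul_of_functional_eq {e q : ℝ → ℝ} {μ C : ℝ} {m : ℕ} (hμ1 : |μ| < 1)
    (he : ∀ x, 0 ≤ e x) (hq : ∀ x, 0 ≤ q x) (hfe : ∀ x, e x = q x * e (μ * x))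
    (hqc : ContinuousAt q 0) (hO : ∀ᶠ x in 𝓝 (0 : ℝ), e x ≤ C * |x| ^ m)
    (hne : ∃ᶠ x in 𝓝 (0 : ℝ), e x ≠ 0) : 1 ≤ |μ| ^ m * q 0 := by
  by_contra! hcon
  have hev : ∀ᶠ y in 𝓝[>] q 0, |μ| ^ m * y < 1 :=
    nhdsWithin_le_nhds ((continuous_const.mul continuous_id).continuousAt.eventually_lt
      continuousAt_const hcon)
  obtain ⟨Q, hQ1, hQ0⟩ := (hev.and self_mem_nhdsWithin).exists
  have hQ0 : q 0 < Q := hQ0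
  have hQpos : 0 < Q := (hq 0).trans_lt hQ0
  obtain ⟨δ, hδ, hball⟩ := Metric.eventually_nhds_iff.1
    ((hqc.eventually_lt continuousAt_const hQ0).and hO)
  obtain ⟨x, hx, hxδ⟩ := (hne.and_eventually (Metric.ball_mem_nhds (0 : ℝ) hδ)).exists
  have hmem : ∀ n : ℕ, dist (μ ^ n * x) 0 < δ := by
    intro n
    rw [dist_zero_right, Real.norm_eq_abs] at hxδ
    rw [dist_zero_right, Real.norm_eq_abs, abs_mul, abs_pow]
    exact (mul_le_of_le_one_left (abs_nonneg x) (pow_le_one₀ (abs_nonneg μ) hμ1.le)).trans_lt hxδ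
  -- Iterating towards 0 costs a factor `Q` per step while the vanishing order gains `|μ| ^ m`. With
  -- `|μ| ^ m * Q < 1` this forces `e x = 0`.
  have hiter : ∀ n : ℕ, e x ≤ Q ^ n * e (μ ^ n * x) := by
    intro n
    induction n with
    | zero => simp
    | succ n ih =>
      refine ih.trans ?_
      rw [hfe (μ ^ n * x), pow_succ, mul_assoc, pow_succ', mul_assoc]
      exact mul_le_mul_of_nonneg_left (mul_le_mul_of_nonneg_right (hball (hmem n)).1.le (he _))
        (by positivity)
  have hbound : ∀ n : ℕ, e x ≤ (|μ| ^ m * Q) ^ n * (C * |x| ^ m) := by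
    intro n
    calc e x ≤ Q ^ n * e (μ ^ n * x) := hiter n
      _ ≤ Q ^ n * (C * |μ ^ n * x| ^ m) :=
        mul_le_mul_of_nonneg_left (hball (hmem n)).2 (by positivity)
      _ = _ := by rw [abs_mul, abs_pow, mul_pow, mul_pow, ← pow_mul, ← pow_mul, mul_comm n m]; ring
  have hlim : Filter.Tendsto (fun n : ℕ => (|μ| ^ m * Q) ^ n * (C * |x| ^ m)) Filter.atTop
      (𝓝 (0 * (C * |x| ^ m))) :=
    (tendsto_pow_atTop_nhds_zero_of_lt_one (by positivity) hQ1).mul_const _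
  rw [zero_mul] at hlim
  exact hx (le_antisymm (ge_of_tendsto' hlim hbound) (he x))

namespace IsUniversalPair

variable {k : ℕ} {lam : ℝ} {D : Set ℂ} {η : ℂ → ℂ}

theorem eq_re (hη : IsUniversalPair k lam D η) (x : ℝ) : η x = ((η x).re : ℂ) :=
  Complex.ext (by simp) (by simp [hη.real x])

theorem differentiableAt (hη : IsUniversalPair k lam D η) (x : ℝ) : DifferentiableAt ℂ η x :=
  hη.holomorphic.differentiableAt (hη.isOpen.mem_nhds (hη.real_subset x))

theorem continuousAt_deriv (hη : IsUniversalPair k lam D η) (x : ℝ) :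
    ContinuousAt (deriv η) x :=
  ((hη.holomorphic.deriv hη.isOpen).differentiableAt
    (hη.isOpen.mem_nhds (hη.real_subset x))).continuousAt

theorem deriv_im (hη : IsUniversalPair k lam D η) (x : ℝ) : (deriv η x).im = 0 := by
  have h1 := (hη.differentiableAt x).hasDerivAt.comp_ofReal
  have h2 : HasDerivAt (fun y : ℝ => (η y).im) (deriv η x).im x :=
    Complex.imCLM.hasFDerivAt.comp_hasDerivAt x h1
  have h3 : (fun y : ℝ => (η y).im) = fun _ => 0 := funext hη.real
  rw [h3] at h2
  exact h2.unique (hasDerivAt_const x 0)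

theorem norm_deriv (hη : IsUniversalPair k lam D η) (x : ℝ) :
    ‖deriv η x‖ = |(deriv η x).re| := by
  have e : deriv η x = ((deriv η x).re : ℂ) := Complex.ext (by simp) (by simp [hη.deriv_im x])
  rw [e, Complex.norm_real, Real.norm_eq_abs]
  simp

theorem phiMap_ofReal (hη : IsUniversalPair k lam D η) (x : ℝ) :
    phiMap lam η x = ((lam⁻¹ * (η ((lam ^ 2 * x : ℝ) : ℂ)).re : ℝ) : ℂ) := by
  have := hη.eq_re (lam ^ 2 * x)
  push_cast at this ⊢
  rw [phiMap, ← this]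

theorem psiMap_ofReal (hη : IsUniversalPair k lam D η) (x : ℝ) :
    psiMap lam η x = ((lam * (η ((lam * x : ℝ) : ℂ)).re : ℝ) : ℂ) := by
  have := hη.eq_re (lam * x)
  push_cast at this ⊢
  rw [psiMap, ← this]

theorem hasDerivAt_phiMap (hη : IsUniversalPair k lam D η) (x : ℝ) :
    HasDerivAt (phiMap lam η)
      ((lam : ℂ)⁻¹ * (deriv η ((lam ^ 2 * x : ℝ) : ℂ) * (lam : ℂ) ^ 2)) (x : ℂ) := by
  have h1 := (hη.differentiableAt (lam ^ 2 * x)).hasDerivAt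
  push_cast at h1 ⊢
  have h2 : HasDerivAt (fun z : ℂ => (lam : ℂ) ^ 2 * z) ((lam : ℂ) ^ 2) x := by
    simpa using (hasDerivAt_id (x : ℂ)).const_mul ((lam : ℂ) ^ 2)
  exact (HasDerivAt.comp (x : ℂ) h1 h2).const_mul _

theorem hasDerivAt_psiMap (hη : IsUniversalPair k lam D η) (x : ℝ) :
    HasDerivAt (psiMap lam η)
      ((lam : ℂ) * (deriv η ((lam * x : ℝ) : ℂ) * (lam : ℂ))) (x : ℂ) := by
  have h1 := (hη.differentiableAt (lam * x)).hasDerivAt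
  push_cast at h1 ⊢
  have h2 : HasDerivAt (fun z : ℂ => (lam : ℂ) * z) (lam : ℂ) x := by
    simpa using (hasDerivAt_id (x : ℂ)).const_mul (lam : ℂ)
  exact (HasDerivAt.comp (x : ℂ) h1 h2).const_mul _

/-- The powers of `lam` from the chain rule cancel: `lam⁻¹ * lam⁻¹ * lam ^ 2 = 1`. The remaining
factor is the weight of the operator. -/
theorem deriv_eq_phi (hη : IsUniversalPair k lam D η) (x : ℝ) :
    deriv η x = deriv η (phiMap lam η x) * deriv η ((lam ^ 2 * x : ℝ) : ℂ) := by
  have hlam : (lam : ℂ) ≠ 0 := Complex.ofReal_ne_zero.2 hη.lam_lt.ne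
  have hd : HasDerivAt η (deriv η (phiMap lam η x)) (phiMap lam η x) := by
    rw [hη.phiMap_ofReal]
    exact (hη.differentiableAt _).hasDerivAt
  have h1 := ((hd.comp (x : ℂ) (hη.hasDerivAt_phiMap x)).const_mul (lam : ℂ)⁻¹).comp_ofReal
  have h2 := (hη.differentiableAt x).hasDerivAt.comp_ofReal
  have h3 : (fun y : ℝ => η y) = fun y : ℝ => (lam : ℂ)⁻¹ * (η ∘ phiMap lam η) y :=
    funext hη.fixed_one
  rw [h3] at h2
  rw [h2.unique h1]
  field_simp

theorem deriv_eq_psi (hη : IsUniversalPair k lam D η) (x : ℝ) :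
    deriv η x = deriv η (psiMap lam η x) * deriv η ((lam * x : ℝ) : ℂ) := by
  have hlam : (lam : ℂ) ≠ 0 := Complex.ofReal_ne_zero.2 hη.lam_lt.ne
  have hd : HasDerivAt η (deriv η (psiMap lam η x)) (psiMap lam η x) := by
    rw [hη.psiMap_ofReal]
    exact (hη.differentiableAt _).hasDerivAt
  have h1 := ((hd.comp (x : ℂ) (hη.hasDerivAt_psiMap x)).const_mul ((lam : ℂ) ^ 2)⁻¹).comp_ofReal
  have h2 := (hη.differentiableAt x).hasDerivAt.comp_ofReal
  have h3 : (fun y : ℝ => η y) = fun y : ℝ => ((lam : ℂ) ^ 2)⁻¹ * (η ∘ psiMap lam η) y :=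
    funext hη.fixed_two
  rw [h3] at h2
  rw [h2.unique h1]
  field_simp

theorem exists_norm_deriv_le (hη : IsUniversalPair k lam D η) :
    ∃ C, ∀ᶠ x : ℝ in 𝓝 0, ‖deriv η x‖ ≤ C * |x| ^ (2 * k) := by
  obtain ⟨H, hH, hηH⟩ := hη.critical
  have hfun : (fun y : ℝ => (η y).re) = fun y => H (y ^ (2 * k + 1)) := funext hηH
  have hderiv : ∀ x : ℝ, (deriv η x).re = deriv H (x ^ (2 * k + 1)) * ((2 * k + 1 : ℕ) * x ^ (2 * k)) := by
    intro x
    have h1 : HasDerivAt (fun y : ℝ => (η y).re) (deriv η x).re x :=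
      (hη.differentiableAt x).hasDerivAt.real_of_complex
    have h2 : HasDerivAt H (deriv H (x ^ (2 * k + 1))) (x ^ (2 * k + 1)) :=
      (hH _ (mem_univ _)).differentiableAt.hasDerivAt
    have h3 : HasDerivAt (fun y : ℝ => H (y ^ (2 * k + 1))) _ x :=
      HasDerivAt.comp x h2 (hasDerivAt_pow (2 * k + 1) x)
    rw [hfun] at h1
    simpa using h1.unique h3
  have hc : ContinuousAt (fun x : ℝ => deriv H (x ^ (2 * k + 1))) 0 :=
    ContinuousAt.comp (f := fun x : ℝ => x ^ (2 * k + 1)) (x := (0 : ℝ))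
      (hH.deriv _ (mem_univ _)).continuousAt (continuous_pow _).continuousAt
  set M : ℝ := |deriv H ((0 : ℝ) ^ (2 * k + 1))| + 1 with hM
  refine ⟨M * (2 * k + 1 : ℕ), ?_⟩
  filter_upwards [hc.abs.eventually_lt continuousAt_const (show _ < M by rw [hM]; linarith)]
    with x hx
  rw [hη.norm_deriv, hderiv, abs_mul, abs_mul, abs_pow, Nat.abs_cast, ← mul_assoc]
  exact mul_le_mul_of_nonneg_right (mul_le_mul_of_nonneg_right hx.le (by positivity))
    (by positivity)

/-- By the mean value theorem, a derivative vanishing near 0 would contradict strict monotonicity.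
-/
theorem frequently_deriv_ne (hη : IsUniversalPair k lam D η) :
    ∃ᶠ x : ℝ in 𝓝 0, ‖deriv η x‖ ≠ 0 := by
  intro hcon
  obtain ⟨δ, hδ, hball⟩ := Metric.eventually_nhds_iff.1 hcon
  have hd : ∀ x : ℝ, HasDerivAt (fun y : ℝ => (η y).re) (deriv η x).re x := fun x =>
    (hη.differentiableAt x).hasDerivAt.real_of_complex
  obtain ⟨c, hc, hc'⟩ := exists_hasDerivAt_eq_slope _ _ (half_pos hδ)
    (fun x _ => (hd x).continuousAt.continuousWithinAt) fun x _ => hd x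
  have h0 : ‖deriv η c‖ = 0 := by
    by_contra h
    refine hball ?_ h
    rw [dist_zero_right, Real.norm_eq_abs, abs_of_pos hc.1]
    linarith [hc.2]
  rw [norm_eq_zero] at h0
  have hlt := hη.strictMono (half_pos hδ)
  rw [h0, Complex.zero_re, eq_comm, div_eq_zero_iff] at hc'
  rcases hc' with h | h
  · simp only at hlt
    linarith
  · linarith

/-- The functional equation is used with `μ = lam ^ 2`, so order `2 * k` produces the square of `lam
^ (2 * k)`. -/
theorem one_le_phi (hη : IsUniversalPair k lam D η) :
    1 ≤ (lam ^ (2 * k)) ^ 2 * ‖deriv η (phiMap lam η 0)‖ := by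
  obtain ⟨C, hC⟩ := hη.exists_norm_deriv_le
  have hcont : ContinuousAt (fun x : ℝ => ‖deriv η (phiMap lam η x)‖) 0 := by
    have hd : ContinuousAt (deriv η) (phiMap lam η ((0 : ℝ) : ℂ)) := by
      rw [hη.phiMap_ofReal]
      exact hη.continuousAt_deriv _
    exact (ContinuousAt.comp (f := fun x : ℝ => phiMap lam η x) (x := (0 : ℝ)) hd
      (hη.hasDerivAt_phiMap 0).comp_ofReal.continuousAt).norm
  have h1 : |lam| < 1 := abs_lt.2 ⟨hη.lam_gt, hη.lam_lt.trans one_pos⟩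
  have := one_le_abs_pow_mul_of_functional_eq (μ := lam ^ 2)
    (by rw [abs_pow]; exact pow_lt_one₀ (abs_nonneg _) h1 two_ne_zero)
    (e := fun x : ℝ => ‖deriv η x‖) (q := fun x : ℝ => ‖deriv η (phiMap lam η x)‖)
    (fun x => norm_nonneg _) (fun x => norm_nonneg _)
    (fun x => by rw [hη.deriv_eq_phi x, norm_mul]) hcont hC hη.frequently_deriv_ne
  rwa [abs_of_nonneg (sq_nonneg lam), ← pow_mul, mul_comm 2, pow_mul, Complex.ofReal_zero] at this

theorem one_le_psi (hη : IsUniversalPair k lam D η) :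
    1 ≤ lam ^ (2 * k) * ‖deriv η (psiMap lam η 0)‖ := by
  obtain ⟨C, hC⟩ := hη.exists_norm_deriv_le
  have hcont : ContinuousAt (fun x : ℝ => ‖deriv η (psiMap lam η x)‖) 0 := by
    have hd : ContinuousAt (deriv η) (psiMap lam η ((0 : ℝ) : ℂ)) := by
      rw [hη.psiMap_ofReal]
      exact hη.continuousAt_deriv _
    exact (ContinuousAt.comp (f := fun x : ℝ => psiMap lam η x) (x := (0 : ℝ)) hd
      (hη.hasDerivAt_psiMap 0).comp_ofReal.continuousAt).norm
  have h1 : |lam| < 1 := abs_lt.2 ⟨hη.lam_gt, hη.lam_lt.trans one_pos⟩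
  have := one_le_abs_pow_mul_of_functional_eq (μ := lam) h1
    (e := fun x : ℝ => ‖deriv η x‖) (q := fun x : ℝ => ‖deriv η (psiMap lam η x)‖)
    (fun x => norm_nonneg _) (fun x => norm_nonneg _)
    (fun x => by rw [hη.deriv_eq_psi x, norm_mul]) hcont hC hη.frequently_deriv_ne
  rwa [pow_mul, sq_abs, ← pow_mul, Complex.ofReal_zero] at this

end IsUniversalPair

/-! ### Application to the two operators. -/

theorem zero_mem_of_mapsTo_mul {B : Compacts ℂ} {c : ℂ} (hc : ‖c‖ < 1)
    (hB : (interior (B : Set ℂ)).Nonempty) (hm : MapsTo (fun z => c * z) B (interior (B : Set ℂ))) :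
    (0 : ℂ) ∈ B := by
  obtain ⟨z, hz⟩ := hB
  have hmem : ∀ n : ℕ, c ^ n * z ∈ (B : Set ℂ) := by
    intro n
    induction n with
    | zero => simpa using interior_subset hz
    | succ n ih =>
      rw [pow_succ', mul_assoc]
      exact interior_subset (hm ih)
  have hlim : Filter.Tendsto (fun n : ℕ => c ^ n * z) Filter.atTop (𝓝 (0 * z)) :=
    (tendsto_pow_atTop_nhds_zero_of_norm_lt_one hc).mul_const z
  rw [zero_mul] at hlim
  exact B.isCompact.isClosed.mem_of_tendsto hlim (Filter.Eventually.of_forall hmem)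

/-- The weak bound at `2 * p` becomes strict at `p`, because `log ρ / p` strictly decreases from `p`
to `2 * p`. -/
theorem IsGrowthRate.one_lt_rpow_mul {X : Type*} [Nonempty X] {s₁ s₂ : X → X} {g₁ g₂ : X → ℝ}
    {ρ : ℝ → ℝ} {κ₁ κ₂ ℓ : ℝ} (hρ : IsGrowthRate s₁ s₂ g₁ g₂ ρ) (hκ₁ : 0 < κ₁) (hκ₂ : 0 < κ₂)
    (hk₁ : HasRate s₁ g₁ κ₁) (hk₂ : HasRate s₂ g₂ κ₂) (hne : κ₁ ^ 2 ≠ κ₂) (hℓ : 0 < ℓ)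
    (hlow : ∀ p, 0 < p → 1 ≤ ℓ ^ p * ρ p) {p : ℝ} (hp : 0 < p) : 1 < ℓ ^ p * ρ p := by
  have hlog : ∀ q, 0 < q → Real.log (ℓ ^ q * ρ q) = q * Real.log ℓ + Real.log (ρ q) := fun q hq => by
    rw [Real.log_mul (Real.rpow_pos_of_pos hℓ _).ne' (hρ.pos q hq.le).ne', Real.log_rpow hℓ]
  have h2p : 0 < 2 * p := by positivity
  have h1 := Real.log_nonneg (hlow (2 * p) h2p)
  rw [hlog _ h2p] at h1
  have h2 := hρ.strictAntiOn_log_div hκ₁ hκ₂ hk₁ hk₂ hne (mem_Ioi.2 hp) (mem_Ioi.2 h2p)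
    (by linarith)
  simp only at h2
  rw [div_lt_div_iff₀ h2p hp] at h2
  have h3 : Real.log (ρ (2 * p)) < 2 * Real.log (ρ p) := by nlinarith
  have h4 : 0 < Real.log (ℓ ^ p * ρ p) := by rw [hlog p hp]; linarith
  exact (Real.log_pos_iff (mul_pos (Real.rpow_pos_of_pos hℓ _) (hρ.pos p hp.le)).le).1 h4

section Operators

variable {k : ℕ} {lam : ℝ} {D : Set ℂ} {η : ℂ → ℂ} {B : Compacts ℂ}

theorem isBranch_phi (hη : IsUniversalPair k lam D η) (hB : IsDomainK lam D η B) :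
    IsBranch B (phiMap lam η) fun _ => 1 where
  mapsTo := hB.mapsTo_phi
  continuousOn _ hz := (hB.differentiableAt_phi hη hz).continuousAt.continuousWithinAt
  differentiableOn _ hz :=
    (hB.differentiableAt_phi hη (interior_subset hz)).differentiableWithinAt
  weight_continuousOn := continuousOn_const
  weight_differentiableOn := differentiableOn_const _
  slit _ _ := Complex.one_mem_slitPlane
  real x := by rw [hη.phiMap_ofReal, Complex.ofReal_im]
  weight_real _ _ := Complex.one_im

theorem isBranch_psi (hη : IsUniversalPair k lam D η) (hB : IsDomainKHat lam D η B) :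
    IsBranch B (psiMap lam η) fun _ => 1 where
  mapsTo := hB.mapsTo_psi
  continuousOn _ hz := (hB.differentiableAt_psi hη hz).continuousAt.continuousWithinAt
  differentiableOn _ hz :=
    (hB.differentiableAt_psi hη (interior_subset hz)).differentiableWithinAt
  weight_continuousOn := continuousOn_const
  weight_differentiableOn := differentiableOn_const _
  slit _ _ := Complex.one_mem_slitPlane
  real x := by rw [hη.psiMap_ofReal, Complex.ofReal_im]
  weight_real _ _ := Complex.one_im

theorem isBranch_sq_mul (hη : IsUniversalPair k lam D η) (hB : IsDomainK lam D η B) :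
    IsBranch B (fun z => (lam : ℂ) ^ 2 * z) fun z => deriv η (phiMap lam η z) := by
  have hd : ∀ z ∈ B, DifferentiableAt ℂ (fun z => deriv η (phiMap lam η z)) z := fun z hz =>
    DifferentiableAt.comp z ((hη.holomorphic.deriv hη.isOpen).differentiableAt
      (hη.isOpen.mem_nhds (hB.subset (interior_subset (hB.mapsTo_phi hz)))))
      (hB.differentiableAt_phi hη hz)
  exact
    { mapsTo := hB.mapsTo_mul
      continuousOn := (continuous_const.mul continuous_id).continuousOn
      differentiableOn := (differentiable_id.const_mul _).differentiableOn
      weight_continuousOn := fun z hz => (hd z hz).continuousAt.continuousWithinAt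
      weight_differentiableOn := fun z hz => (hd z (interior_subset hz)).differentiableWithinAt
      slit := hB.slit
      real := fun x => by
        rw [← Complex.ofReal_pow, ← Complex.ofReal_mul, Complex.ofReal_im]
      weight_real := fun x _ => by rw [hη.phiMap_ofReal]; exact hη.deriv_im _ }

theorem isBranch_mul (hη : IsUniversalPair k lam D η) (hB : IsDomainKHat lam D η B) :
    IsBranch B (fun z => (lam : ℂ) * z) fun z => deriv η (psiMap lam η z) := by
  have hd : ∀ z ∈ B, DifferentiableAt ℂ (fun z => deriv η (psiMap lam η z)) z := fun z hz =>
    DifferentiableAt.comp z ((hη.holomorphic.deriv hη.isOpen).differentiableAt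
      (hη.isOpen.mem_nhds (hB.subset (interior_subset (hB.mapsTo_psi hz)))))
      (hB.differentiableAt_psi hη hz)
  exact
    { mapsTo := hB.mapsTo_mul
      continuousOn := (continuous_const.mul continuous_id).continuousOn
      differentiableOn := (differentiable_id.const_mul _).differentiableOn
      weight_continuousOn := fun z hz => (hd z hz).continuousAt.continuousWithinAt
      weight_differentiableOn := fun z hz => (hd z (interior_subset hz)).differentiableWithinAt
      slit := hB.slit
      real := fun x => by rw [← Complex.ofReal_mul, Complex.ofReal_im]
      weight_real := fun x _ => by rw [hη.psiMap_ofReal]; exact hη.deriv_im _ }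

theorem isCompanionFamily_opK (hη : IsUniversalPair k lam D η) (hB : IsDomainK lam D η B) :
    IsBranch.IsCompanionFamily (isBranch_phi hη hB) (isBranch_sq_mul hη hB) (opK hη hB) := by
  refine fun p f => ⟨fun z => ?_, rfl⟩
  rw [Complex.one_cpow]
  rfl

theorem isCompanionFamily_opKHat (hη : IsUniversalPair k lam D η) (hB : IsDomainKHat lam D η B) :
    IsBranch.IsCompanionFamily (isBranch_mul hη hB) (isBranch_psi hη hB) (opKHat hη hB) := by
  refine fun p f => ⟨fun z => ?_, rfl⟩
  rw [Complex.one_cpow]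
  rfl

theorem hasRate_weight_one {τ : ℂ → ℂ} (h : IsBranch B τ fun _ => 1) :
    HasRate h.toMap h.weight 1 := by
  have : h.weight = fun _ => 1 := funext fun z => norm_one
  rw [this]
  exact IsContractedBranch.hasRate_one _

theorem rhoK_properties (hk : 1 ≤ k) (hη : IsUniversalPair k lam D η)
    (hB : IsDomainK lam D η B) :
    (∀ p : ℝ, 0 < p → 1 < (lam ^ (2 * k)) ^ p * rhoK hη hB p) ∧
      StrictLogConvexOn (Ici 0) (fun p => rhoK hη hB p) ∧
      StrictAntiOn (fun p => Real.log (rhoK hη hB p) / p) (Ioi 0) := by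
  have habs : |lam| < 1 := abs_lt.2 ⟨hη.lam_gt, hη.lam_lt.trans one_pos⟩
  have h0 : (0 : ℂ) ∈ B := zero_mem_of_mapsTo_mul
    (by rw [norm_pow, Complex.norm_real]; exact pow_lt_one₀ (abs_nonneg _) habs two_ne_zero)
    hB.connected.nonempty hB.mapsTo_mul
  have : Nonempty B := ⟨⟨0, h0⟩⟩
  set h₁ := isBranch_phi hη hB
  set h₂ := isBranch_sq_mul hη hB
  have hρ : IsGrowthRate h₁.toMap h₂.toMap h₁.weight h₂.weight (rhoK hη hB) :=
    IsBranch.isGrowthRate (isCompanionFamily_opK hη hB) hB.connected.isPreconnected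
      (z₀ := ⟨0, h0⟩) Complex.zero_im
  obtain ⟨L, d, A, θ, D', -, hb₂⟩ := h₁.exists_isContractedBranch h₂ hB.connected.isPreconnected
  have hfix : h₂.toMap ⟨0, h0⟩ = ⟨0, h0⟩ := Subtype.ext (mul_zero _)
  have hk₁ := hasRate_weight_one h₁
  have hk₂ := hb₂.hasRate_of_fixed hfix
  set κ : ℝ := h₂.weight ⟨0, h0⟩ with hκ
  have hκ0 : 0 < κ := h₂.weight_pos _
  set ℓ : ℝ := lam ^ (2 * k) with hℓ
  have hℓ0 : 0 < ℓ := by rw [hℓ, pow_mul]; exact pow_pos (by nlinarith [hη.lam_lt]) _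
  have hℓ1 : ℓ < 1 := by
    rw [hℓ, pow_mul, ← sq_abs, ← pow_mul]
    exact pow_lt_one₀ (abs_nonneg _) habs (by omega)
  have hκℓ : 1 ≤ ℓ ^ 2 * κ := hη.one_le_phi
  -- The length-one branch has weight 1, whereas `κ ≥ ℓ⁻² > 1` since `k ≥ 1`.
  have hne : (1 : ℝ) ^ 2 ≠ κ := by
    intro h
    rw [← h] at hκℓ
    nlinarith
  have hlow : ∀ p, 0 < p → 1 ≤ ℓ ^ p * rhoK hη hB p := by
    intro p hp
    have h1 := hρ.rate₂_le hκ0 hk₂ hp.le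
    have h2 : 1 ≤ (ℓ ^ p) ^ 2 * κ ^ p := by
      have := Real.one_le_rpow hκℓ hp.le
      rwa [Real.mul_rpow (by positivity) hκ0.le, ← Real.rpow_natCast, ← Real.rpow_mul hℓ0.le,
        mul_comm _ p, Real.rpow_mul hℓ0.le, Real.rpow_natCast] at this
    have h3 : 0 < ℓ ^ p := Real.rpow_pos_of_pos hℓ0 _
    have h4 : 1 ≤ (ℓ ^ p * rhoK hη hB p) ^ 2 := by
      rw [mul_pow]
      exact h2.trans (mul_le_mul_of_nonneg_left h1 (by positivity))
    exact (one_le_sq_iff₀ (mul_pos h3 (hρ.pos p hp.le)).le).1 h4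
  exact ⟨fun p hp => hρ.one_lt_rpow_mul one_pos hκ0 hk₁ hk₂ hne hℓ0 hlow hp,
    ⟨fun p hp => hρ.pos p hp, hρ.strictConvexOn_log one_pos hκ0 hk₁ hk₂ hne⟩,
    hρ.strictAntiOn_log_div one_pos hκ0 hk₁ hk₂ hne⟩

theorem rhoKHat_properties (hk : 1 ≤ k) (hη : IsUniversalPair k lam D η)
    (hB : IsDomainKHat lam D η B) :
    (∀ p : ℝ, 0 < p → 1 < (lam ^ (2 * k)) ^ p * rhoKHat hη hB p) ∧
      StrictLogConvexOn (Ici 0) (fun p => rhoKHat hη hB p) ∧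
      StrictAntiOn (fun p => Real.log (rhoKHat hη hB p) / p) (Ioi 0) := by
  have habs : |lam| < 1 := abs_lt.2 ⟨hη.lam_gt, hη.lam_lt.trans one_pos⟩
  have h0 : (0 : ℂ) ∈ B := zero_mem_of_mapsTo_mul
    (by rw [Complex.norm_real]; exact habs) hB.connected.nonempty hB.mapsTo_mul
  have : Nonempty B := ⟨⟨0, h0⟩⟩
  set h₁ := isBranch_mul hη hB
  set h₂ := isBranch_psi hη hB
  have hρ : IsGrowthRate h₁.toMap h₂.toMap h₁.weight h₂.weight (rhoKHat hη hB) :=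
    IsBranch.isGrowthRate (isCompanionFamily_opKHat hη hB) hB.connected.isPreconnected
      (z₀ := ⟨0, h0⟩) Complex.zero_im
  obtain ⟨L, d, A, θ, D', hb₁, -⟩ := h₁.exists_isContractedBranch h₂ hB.connected.isPreconnected
  have hfix : h₁.toMap ⟨0, h0⟩ = ⟨0, h0⟩ := Subtype.ext (mul_zero _)
  have hk₁ := hb₁.hasRate_of_fixed hfix
  have hk₂ := hasRate_weight_one h₂
  set κ : ℝ := h₁.weight ⟨0, h0⟩ with hκ
  have hκ0 : 0 < κ := h₁.weight_pos _
  set ℓ : ℝ := lam ^ (2 * k) with hℓ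
  have hℓ0 : 0 < ℓ := by rw [hℓ, pow_mul]; exact pow_pos (by nlinarith [hη.lam_lt]) _
  have hℓ1 : ℓ < 1 := by
    rw [hℓ, pow_mul, ← sq_abs, ← pow_mul]
    exact pow_lt_one₀ (abs_nonneg _) habs (by omega)
  have hκℓ : 1 ≤ ℓ * κ := hη.one_le_psi
  -- Here the derivative weight sits on the length-one branch, so `ℓ * κ ≥ 1` is enough in place of
  -- `ℓ ^ 2 * κ ≥ 1`.
  have hκ1 : 1 < κ := by nlinarith
  have hne : κ ^ 2 ≠ (1 : ℝ) := by nlinarith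
  have hlow : ∀ p, 0 < p → 1 ≤ ℓ ^ p * rhoKHat hη hB p := by
    intro p hp
    have h2 := Real.one_le_rpow hκℓ hp.le
    rw [Real.mul_rpow hℓ0.le hκ0.le] at h2
    exact h2.trans (mul_le_mul_of_nonneg_left (hρ.rate₁_le hκ0 hk₁ hp.le)
      (Real.rpow_nonneg hℓ0.le _))
  exact ⟨fun p hp => hρ.one_lt_rpow_mul hκ0 one_pos hk₁ hk₂ hne hℓ0 hlow hp,
    ⟨fun p hp => hρ.pos p hp, hρ.strictConvexOn_log hκ0 one_pos hk₁ hk₂ hne⟩,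
    hρ.strictAntiOn_log_div hκ0 one_pos hk₁ hk₂ hne⟩

end Operators

end

theorem theorem7 (k : ℕ) (hk : 1 ≤ k) (lam : ℝ) (D : Set ℂ) (η : ℂ → ℂ)
    (hη : IsUniversalPair k lam D η) :
    (∀ (B : TopologicalSpace.Compacts ℂ) (hB : IsDomainK lam D η B),
      (∀ p : ℝ, 0 < p → 1 < (lam ^ (2 * k)) ^ p * rhoK hη hB p) ∧
      StrictLogConvexOn (Set.Ici 0) (fun p => rhoK hη hB p) ∧
      StrictAntiOn (fun p => Real.log (rhoK hη hB p) / p) (Set.Ioi 0)) ∧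
    (∀ (B : TopologicalSpace.Compacts ℂ) (hB : IsDomainKHat lam D η B),
      (∀ p : ℝ, 0 < p → 1 < (lam ^ (2 * k)) ^ p * rhoKHat hη hB p) ∧
      StrictLogConvexOn (Set.Ici 0) (fun p => rhoKHat hη hB p) ∧
      StrictAntiOn (fun p => Real.log (rhoKHat hη hB p) / p) (Set.Ioi 0)) := by
  exact ⟨fun _ hB => rhoK_properties hk hη hB, fun _ hB => rhoKHat_properties hk hη hB⟩
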